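/- Let $M$ be a connected, oriented smooth surface and $x:M\to\mathbb E^4_1$ a smooth space-like immersion into the Minkowski space-time ($\mathbb R^4$ with $\langle v,w\rangle=-v_1w_1+v_2w_2+v_3w_3+v_4w_4$) that is marginally trapped, i.e. its mean curvature vector $H=\frac12\operatorname{tr}h$ is light-like ($H\neq0$, $\langle H,H\rangle=0$) at every point. Let $\Delta=\sum_{i=1}^2(-e_ie_i+\nabla_{e_i}e_i)$ be the Laplace operator of the induced metric ($e_1,e_2$ a local orthonormal tangent frame), acting componentwise on vector-valued maps, and let $\nu=e_1\wedge e_2:M\to\Lambda^2(\mathbb E^4_1)$ be the Gauss map ($e_1,e_2$ positively oriented). Suppose that $\nu$ is of 1-type, $\Delta\nu=\lambda(\nu+C)$ for some constant $\lambda\in\mathbb R$ and some constant $C\in\Lambda^2(\mathbb E^4_1)$, and that $\nu$ is not harmonic, i.e. $\Delta\nu\not\equiv0$. Then $M$ is of null 2-type: $\lambda\neq0$, and there are non-constant smooth maps $x_0,x_1:M\to\mathbb E^4_1$ with $$x=x_0+x_1,\qquad \Delta x_0=0,\qquad \Delta x_1=\lambda x_1 .$$ -/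

import Mathlib

open scoped Manifold ContDiff

noncomputable section

namespace MargTrapped

/-- The underlying vector space of the Minkowski space-time `E^4_1` (its norm is used only for its
topology and smooth structure; the geometry comes from `mink`). -/
abbrev Mink4 : Type := Fin 4 → ℝ

/-- The Minkowski inner product `-v₁w₁ + v₂w₂ + v₃w₃ + v₄w₄`. -/
def mink (v w : Mink4) : ℝ := -(v 0 * w 0) + v 1 * w 1 + v 2 * w 2 + v 3 * w 3

/-- The coordinate plane. -/
abbrev Plane : Type := EuclideanSpace ℝ (Fin 2)

/-- The six-dimensional space of 2-vectors of `E^4_1`, in coordinates with respect to the basis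
`E_i ∧ E_j`, `i < j`, where `E_i` is the standard basis. -/
abbrev BiVec : Type := {q : Fin 4 × Fin 4 // q.1 < q.2} → ℝ

/-- The wedge product `v ∧ w`. -/
def wedge (v w : Mink4) : BiVec := fun q => v q.1.1 * w q.1.2 - v q.1.2 * w q.1.1

section Coordinates

variable {F : Type*} [NormedAddCommGroup F] [NormedSpace ℝ F]

/-- The partial derivative `∂_i f` of a map on the coordinate plane. -/
def pd (i : Fin 2) (f : Plane → F) (u : Plane) : F :=
  fderiv ℝ f u (EuclideanSpace.single i 1)

/-- The coefficients `g_ij = ⟨∂_i X, ∂_j X⟩` of the metric induced by a parametrization `X`. -/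
def metric (X : Plane → Mink4) (u : Plane) : Matrix (Fin 2) (Fin 2) ℝ :=
  Matrix.of fun i j => mink (pd i X u) (pd j X u)

/-- The Christoffel symbols `Γ^k_ij` of the Levi-Civita connection of the induced metric. -/
def christoffel (X : Plane → Mink4) (u : Plane) (k i j : Fin 2) : ℝ :=
  (1 / 2) * ∑ l, (metric X u)⁻¹ k l *
    (pd i (fun y => metric X y j l) u + pd j (fun y => metric X y i l) u
      - pd l (fun y => metric X y i j) u)

/-- The second fundamental form `h(∂_i, ∂_j)`, from the Gauss formula: the derivative `∂_i ∂_j X`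
in the flat ambient space minus the Levi-Civita derivative `Γ^k_ij ∂_k X`. -/
def secondFundamentalForm (X : Plane → Mink4) (u : Plane) (i j : Fin 2) : Mink4 :=
  pd i (pd j X) u - ∑ k, christoffel X u k i j • pd k X u

/-- The mean curvature vector `(1/2) tr h` of a parametrization. -/
def coordMeanCurvature (X : Plane → Mink4) (u : Plane) : Mink4 :=
  (1 / 2 : ℝ) • ∑ i, ∑ j, (metric X u)⁻¹ i j • secondFundamentalForm X u i j

/-- The Laplacian of the induced metric, with the sign of `-∂²`:
`Δ f = -g^ij (∂_i ∂_j f - Γ^k_ij ∂_k f)`. -/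
def coordLaplacian (X : Plane → Mink4) (f : Plane → F) (u : Plane) : F :=
  -∑ i, ∑ j, (metric X u)⁻¹ i j • (pd i (pd j f) u - ∑ k, christoffel X u k i j • pd k f u)

end Coordinates

section Surface

variable {M : Type*} [TopologicalSpace M] [ChartedSpace Plane M]
  {F : Type*} [NormedAddCommGroup F] [NormedSpace ℝ F]

/-- The map `f` read in the chart at `p`. -/
def inChart (p : M) (f : M → F) : Plane → F := f ∘ (extChartAt (𝓡 2) p).symm

/-- The mean curvature vector `H` of the surface `x : M → E^4_1` (independent of coordinates;
computed at `p` in the chart at `p`). -/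
def meanCurvature (x : M → Mink4) (p : M) : Mink4 :=
  coordMeanCurvature (inChart p x) (extChartAt (𝓡 2) p p)

/-- The Laplacian `Δ` of the metric induced by `x : M → E^4_1`, on vector-valued maps
(independent of coordinates; computed at `p` in the chart at `p`). -/
def laplacian (x : M → Mink4) (f : M → F) (p : M) : F :=
  coordLaplacian (inChart p x) (inChart p f) (extChartAt (𝓡 2) p p)

/-- The image `dx_p(v)` of a tangent vector, as a vector of `E^4_1`. -/
def push (x : M → Mink4) (p : M) (v : TangentSpace (𝓡 2) p) : Mink4 :=
  mfderiv (𝓡 2) 𝓘(ℝ, Mink4) x p v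

/-- `x : M → E^4_1` is a smooth space-like immersed surface: every non-zero tangent vector is
space-like (in particular `dx_p` is injective). -/
structure IsSpacelikeSurface (x : M → Mink4) : Prop where
  smooth : ContMDiff (𝓡 2) 𝓘(ℝ, Mink4) ∞ x
  spacelike : ∀ (p : M) (v : TangentSpace (𝓡 2) p), v ≠ 0 → 0 < mink (push x p v) (push x p v)

/-- A light-like vector: non-zero and of zero square. -/
def IsLightlike (v : Mink4) : Prop := v ≠ 0 ∧ mink v v = 0

/-- A marginally trapped surface: space-like with light-like mean curvature vector everywhere. -/
structure IsMarginallyTrapped (x : M → Mink4) : Prop extends IsSpacelikeSurface x where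
  lightlike : ∀ p, IsLightlike (meanCurvature x p)

/-- `ν = e₁ ∧ e₂` is the Gauss map of `x` for some orientation of `M`: a smooth map whose value at
`p` is `e₁ ∧ e₂` for an orthonormal basis `e₁, e₂` of the tangent plane at `p`. The two possible
values of `ν p` are the two orientations of the plane, so choosing `ν` is choosing an
orientation of `M`. -/
structure IsGaussMap (x : M → Mink4) (ν : M → BiVec) : Prop where
  smooth : ContMDiff (𝓡 2) 𝓘(ℝ, BiVec) ∞ ν
  eq_wedge : ∀ p, ∃ v w : TangentSpace (𝓡 2) p,
    mink (push x p v) (push x p v) = 1 ∧ mink (push x p w) (push x p w) = 1 ∧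
    mink (push x p v) (push x p w) = 0 ∧ ν p = wedge (push x p v) (push x p w)

/-- `f` is harmonic: `Δ f ≡ 0`. -/
def IsHarmonic (x : M → Mink4) (f : M → F) : Prop := ∀ p, laplacian x f p = 0

/-- `Δ f = lam (f + C)` for the constant `lam` and some constant vector `C`. -/
def IsOneTypeWith (x : M → Mink4) (f : M → F) (lam : ℝ) : Prop :=
  ∃ C : F, ∀ p, laplacian x f p = lam • (f p + C)

/-- The surface is of null 2-type with non-zero eigenvalue `lam`: the position vector is a sum
`x = x₀ + x₁` of non-constant smooth maps with `Δ x₀ = 0` and `Δ x₁ = lam x₁`, `lam ≠ 0`. -/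
def IsNullTwoTypeWith (x : M → Mink4) (lam : ℝ) : Prop :=
  lam ≠ 0 ∧ ∃ x₀ x₁ : M → Mink4,
    ContMDiff (𝓡 2) 𝓘(ℝ, Mink4) ∞ x₀ ∧ ContMDiff (𝓡 2) 𝓘(ℝ, Mink4) ∞ x₁ ∧
    (∀ p, x p = x₀ p + x₁ p) ∧
    (∀ p, laplacian x x₀ p = 0) ∧ (∀ p, laplacian x x₁ p = lam • x₁ p) ∧
    (¬ ∃ c, ∀ p, x₀ p = c) ∧ (¬ ∃ c, ∀ p, x₁ p = c)

end Surface

end MargTrapped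

end

/-! Take an orthonormal tangent frame e₁, e₂ and the null normal L with ⟨H, L⟩ = -1. Since ⟨H, H⟩ =
0, the shape operator of H is trace-free, with entries a, b, and the normal derivative of H is a
multiple ω of H. The shape operator of L is -1 plus a trace-free part with entries c, d. By the
Codazzi equations, Δν has only the components ν, H∧e₁, H∧e₂ and H∧L (`lap_gauss_map`), with
coefficients built from ac + bd, ω and bc - ad.

If Δν = λ(ν + C), then Δν - λν is constant. The components of its derivative
(`components_of_one_type`) show that where a² + b² ≠ 0 the normal curvature term bc - ad and ω
vanish and the Gauss curvature 2(ac + bd) equals -λ/2. If λ ≠ 0 there, (c, d) is a multiple of (a,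
b), and comparing the two Codazzi equations makes a² + b² locally constant. A trace-free Codazzi
tensor of constant non-zero norm is parallel up to the rotation of the frame, so the surface is
flat, a contradiction. Hence λ ≠ 0 forces a = b = 0 everywhere (`mul_eigenvalue_eq_zero`). Then the
derivative of H is ωH, and the remaining components give ΔH = λH (`lap_H_of_flat`).

As Δx = -2H, the decomposition is x₁ = -(2/λ)H and x₀ = x - x₁. Here x₁ is not constant because H ≠
0, and x₀ is not constant because the shape operator of H is trace-free (`not_radial`).

The frame computation takes place in the ring of smooth functions on a chart domain. "y = 0 where s
≠ 0" becomes s * y = 0, and the identities become `linear_combination` certificates. Non-harmonicity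
serves only to give λ ≠ 0. -/

noncomputable section

namespace MargTrapped

/-! ### Minkowski algebra over a commutative ring and the structure equations of an adapted frame -/

section Algebra

variable {R : Type*} [CommRing R]

/-- The Minkowski product of vectors with entries in a commutative ring. -/
def rmink (v w : Fin 4 → R) : R := -(v 0 * w 0) + v 1 * w 1 + v 2 * w 2 + v 3 * w 3

/-- The `(i, j)` entry of `v ∧ w`. -/
def rwedge (v w : Fin 4 → R) (i j : Fin 4) : R := v i * w j - v j * w i

/-- Contraction of a matrix of coefficients with two vectors. -/
def contract (B : Fin 4 → Fin 4 → R) (v w : Fin 4 → R) : R :=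
  rmink (fun i => rmink (fun j => B i j) w) v

lemma rmink_comm (v w : Fin 4 → R) : rmink v w = rmink w v := by
  simp only [rmink]; ring

lemma rmink_combination (α β γ δ : R) (v₁ v₂ v₃ v₄ w : Fin 4 → R) :
    rmink (fun k => α * v₁ k + β * v₂ k + γ * v₃ k + δ * v₄ k) w =
      α * rmink v₁ w + β * rmink v₂ w + γ * rmink v₃ w + δ * rmink v₄ w := by
  simp only [rmink]; ring

lemma contract_rwedge (v w y z : Fin 4 → R) :
    contract (rwedge v w) y z = rmink v y * rmink w z - rmink w y * rmink v z := by
  simp only [contract, rwedge, rmink]; ring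

/-- A moving frame along a marginally trapped surface: two derivations, an orthonormal tangent
frame `e₁, e₂`, the mean curvature vector `H` and the null normal `L` with `⟨H, L⟩ = -1`, with the
structure equations. -/
structure AdaptedFrame (R : Type*) [CommRing R] [Algebra ℝ R] where
  (D₁ D₂ : Derivation ℝ R R)
  (e₁ e₂ H L : Fin 4 → R)
  (p q a b c d ω₁ ω₂ : R)
  e₁e₁ : rmink e₁ e₁ = 1
  e₂e₂ : rmink e₂ e₂ = 1
  e₁e₂ : rmink e₁ e₂ = 0
  e₁H : rmink e₁ H = 0
  e₂H : rmink e₂ H = 0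
  e₁L : rmink e₁ L = 0
  e₂L : rmink e₂ L = 0
  HH : rmink H H = 0
  LL : rmink L L = 0
  HL : rmink H L = -1
  D₁e₁ : ∀ k, D₁ (e₁ k) = p * e₂ k + (1 - c) * H k - a * L k
  D₂e₁ : ∀ k, D₂ (e₁ k) = q * e₂ k - d * H k - b * L k
  D₁e₂ : ∀ k, D₁ (e₂ k) = -p * e₁ k - d * H k - b * L k
  D₂e₂ : ∀ k, D₂ (e₂ k) = -q * e₁ k + (1 + c) * H k + a * L k
  D₁H : ∀ k, D₁ (H k) = -a * e₁ k - b * e₂ k + ω₁ * H k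
  D₂H : ∀ k, D₂ (H k) = -b * e₁ k + a * e₂ k + ω₂ * H k
  D₁L : ∀ k, D₁ (L k) = (1 - c) * e₁ k - d * e₂ k - ω₁ * L k
  D₂L : ∀ k, D₂ (L k) = -d * e₁ k + (1 + c) * e₂ k - ω₂ * L k
  comm : ∀ f, D₁ (D₂ f) - D₂ (D₁ f) = -p * D₁ f - q * D₂ f

namespace AdaptedFrame

variable [Algebra ℝ R] (S : AdaptedFrame R)

/-- The Laplacian of the frame. -/
def lap (f : R) : R :=
  -(S.D₁ (S.D₁ f) + S.D₂ (S.D₂ f) - S.p * S.D₂ f + S.q * S.D₁ f)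

/-- The Gram matrix of the frame is invertible over any ring: pairing with e₁, e₂, L, H isolates
each coefficient up to sign, H and L being dual to each other. -/
lemma coeff_eq_zero {α β γ δ : R}
    (h : ∀ k, α * S.e₁ k + β * S.e₂ k + γ * S.H k + δ * S.L k = 0) :
    α = 0 ∧ β = 0 ∧ γ = 0 ∧ δ = 0 := by
  have key (w : Fin 4 → R) :
      α * rmink S.e₁ w + β * rmink S.e₂ w + γ * rmink S.H w + δ * rmink S.L w = 0 := by
    rw [← rmink_combination]; simp [rmink, h]
  have h₁ := key S.e₁
  have h₂ := key S.e₂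
  have h₃ := key S.H
  have h₄ := key S.L
  rw [S.e₁e₁, rmink_comm, S.e₁e₂, rmink_comm S.H, S.e₁H, rmink_comm S.L, S.e₁L] at h₁
  rw [S.e₁e₂, S.e₂e₂, rmink_comm S.H, S.e₂H, rmink_comm S.L, S.e₂L] at h₂
  rw [S.e₁H, S.e₂H, S.HH, rmink_comm S.L, S.HL] at h₃
  rw [S.e₁L, S.e₂L, S.HL, S.LL] at h₄
  refine ⟨?_, ?_, ?_, ?_⟩
  · linear_combination h₁
  · linear_combination h₂
  · linear_combination -h₄
  · linear_combination -h₃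

/-- For fixed j the relation is one between frame vectors in the index i. Its vanishing coefficients
are in turn relations between frame vectors in j. -/
lemma wedge_coeff_eq_zero {α β γ δ ε ζ : R}
    (h : ∀ i j, α * rwedge S.e₁ S.e₂ i j + β * rwedge S.H S.e₁ i j + γ * rwedge S.H S.e₂ i j
      + δ * rwedge S.L S.e₁ i j + ε * rwedge S.L S.e₂ i j + ζ * rwedge S.H S.L i j = 0) :
    α = 0 ∧ β = 0 ∧ γ = 0 ∧ δ = 0 ∧ ε = 0 ∧ ζ = 0 := by
  have h₁ (j : Fin 4) := S.coeff_eq_zero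
    (α := α * S.e₂ j - β * S.H j - δ * S.L j) (β := -α * S.e₁ j - γ * S.H j - ε * S.L j)
    (γ := β * S.e₁ j + γ * S.e₂ j + ζ * S.L j) (δ := δ * S.e₁ j + ε * S.e₂ j - ζ * S.H j)
    (fun i => by have := h i j; simp only [rwedge] at this; linear_combination this)
  have h₂ := S.coeff_eq_zero (α := 0) (β := α) (γ := -β) (δ := -δ)
    (fun j => by linear_combination (h₁ j).1)
  have h₃ := S.coeff_eq_zero (α := β) (β := γ) (γ := 0) (δ := ζ)
    (fun j => by linear_combination (h₁ j).2.2.1)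
  have h₄ := S.coeff_eq_zero (α := δ) (β := ε) (γ := -ζ) (δ := 0)
    (fun j => by linear_combination (h₁ j).2.2.2)
  exact ⟨h₂.2.1, h₃.1, h₃.2.1, h₄.1, h₄.2.1, h₃.2.2.2⟩

/-- Tangential components of the commutator identity for D₁, D₂ on H. The H component, carried along
as γ, is the Ricci equation and is not kept. -/
lemma codazzi_H :
    -S.D₁ S.b + S.D₂ S.a - 2 * S.a * S.p - 2 * S.b * S.q - S.a * S.ω₂ + S.b * S.ω₁ = 0 ∧
    S.D₁ S.a + S.D₂ S.b - 2 * S.b * S.p + 2 * S.a * S.q - S.b * S.ω₂ - S.a * S.ω₁ = 0 := by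
  have h := S.coeff_eq_zero
    (α := -S.D₁ S.b + S.D₂ S.a - 2 * S.a * S.p - 2 * S.b * S.q - S.a * S.ω₂ + S.b * S.ω₁)
    (β := S.D₁ S.a + S.D₂ S.b - 2 * S.b * S.p + 2 * S.a * S.q - S.b * S.ω₂ - S.a * S.ω₁)
    (γ := 2 * S.b * S.c - 2 * S.a * S.d + S.D₁ S.ω₂ - S.D₂ S.ω₁ + S.p * S.ω₁ + S.q * S.ω₂)
    (δ := 0) (fun k => by
      have := S.comm (S.H k)
      simp only [S.D₁H, S.D₂H, S.D₁e₁, S.D₂e₁, S.D₁e₂, S.D₂e₂, map_add, map_sub, map_neg,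
        Derivation.leibniz, smul_eq_mul, neg_mul] at this
      linear_combination this)
  exact ⟨h.1, h.2.1⟩

lemma codazzi_L :
    -S.D₁ S.d + S.D₂ S.c - 2 * S.c * S.p - 2 * S.d * S.q - (1 - S.c) * S.ω₂ - S.d * S.ω₁ = 0 ∧
    S.D₁ S.c + S.D₂ S.d - 2 * S.d * S.p + 2 * S.c * S.q + S.d * S.ω₂ + (1 + S.c) * S.ω₁ = 0 := by
  have h := S.coeff_eq_zero
    (α := -S.D₁ S.d + S.D₂ S.c - 2 * S.c * S.p - 2 * S.d * S.q - (1 - S.c) * S.ω₂ - S.d * S.ω₁)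
    (β := S.D₁ S.c + S.D₂ S.d - 2 * S.d * S.p + 2 * S.c * S.q + S.d * S.ω₂ + (1 + S.c) * S.ω₁)
    (γ := 0)
    (δ := -(2 * S.b * S.c - 2 * S.a * S.d + S.D₁ S.ω₂ - S.D₂ S.ω₁ + S.p * S.ω₁ + S.q * S.ω₂))
    (fun k => by
      have := S.comm (S.L k)
      simp only [S.D₁L, S.D₂L, S.D₁e₁, S.D₂e₁, S.D₁e₂, S.D₂e₂, map_add, map_sub, map_neg,
        Derivation.leibniz, smul_eq_mul, neg_mul, Derivation.map_one_eq_zero] at this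
      linear_combination this)
  exact ⟨h.1, h.2.1⟩

/-- The e₂ component of the commutator identity on e₁. It says that the Gauss curvature is 2(ac +
bd). -/
lemma gauss :
    S.D₁ S.q - S.D₂ S.p + S.p ^ 2 + S.q ^ 2 + 2 * S.b * S.d + 2 * S.a * S.c = 0 := by
  have h := S.coeff_eq_zero (α := 0)
    (β := S.D₁ S.q - S.D₂ S.p + S.p ^ 2 + S.q ^ 2 + 2 * S.b * S.d + 2 * S.a * S.c)
    (γ := 0) (δ := 0) (fun k => by
      have := S.comm (S.e₁ k)
      simp only [S.D₁H, S.D₂H, S.D₁L, S.D₂L, S.D₁e₁, S.D₂e₁, S.D₁e₂, S.D₂e₂, map_add, map_sub,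
        Derivation.leibniz, smul_eq_mul, neg_mul, Derivation.map_one_eq_zero] at this
      -- The normal components of the identity are Codazzi equations and are subtracted.
      linear_combination this - S.codazzi_L.1 * S.H k - S.codazzi_H.1 * S.L k)
  exact h.2.1

/-- Second derivatives of ν involve first derivatives of a, b, c, d only in the combinations of the
Codazzi equations. The L∧eᵢ terms cancel because the normal derivative of H has no L part, and the
H∧eᵢ terms reduce to ω. -/
lemma lap_gauss_map (i j : Fin 4) :
    S.lap (rwedge S.e₁ S.e₂ i j) = -4 * (S.a * S.c + S.b * S.d) * rwedge S.e₁ S.e₂ i j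
      - 2 * S.ω₁ * rwedge S.H S.e₂ i j + 2 * S.ω₂ * rwedge S.H S.e₁ i j
      - 4 * (S.c * S.b - S.a * S.d) * rwedge S.H S.L i j := by
  obtain ⟨c₁, c₂⟩ := S.codazzi_H
  obtain ⟨c₃, c₄⟩ := S.codazzi_L
  simp only [lap, rwedge, S.D₁H, S.D₂H, S.D₁L, S.D₂L, S.D₁e₁, S.D₂e₁, S.D₁e₂, S.D₂e₂, map_add,
    map_sub, map_neg, Derivation.leibniz, smul_eq_mul, neg_mul, Derivation.map_one_eq_zero]
  linear_combination (S.H i * S.e₂ j - S.H j * S.e₂ i) * c₄ + (S.H i * S.e₁ j - S.H j * S.e₁ i) * c₃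
    + (S.L i * S.e₂ j - S.L j * S.e₂ i) * c₂ + (S.L i * S.e₁ j - S.L j * S.e₁ i) * c₁

/-- The components of `∇ (Δν - lν)`, when it vanishes. -/
lemma components_of_one_type {l : R}
    (h₁ : ∀ i j, S.D₁ (S.lap (rwedge S.e₁ S.e₂ i j) - l * rwedge S.e₁ S.e₂ i j) = 0)
    (h₂ : ∀ i j, S.D₂ (S.lap (rwedge S.e₁ S.e₂ i j) - l * rwedge S.e₁ S.e₂ i j) = 0)
    {f κ : R} (hf : f = -4 * (S.a * S.c + S.b * S.d) - l)
    (hκ : κ = 4 * (S.c * S.b - S.a * S.d)) :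
    (S.D₁ f + 2 * S.a * S.ω₁ + 2 * S.b * S.ω₂ = 0 ∧
      f * (1 - S.c) - 2 * S.D₁ S.ω₁ - 2 * S.ω₁ ^ 2 + 2 * S.p * S.ω₂ + κ * S.d = 0 ∧
      f * S.b - κ * S.a = 0 ∧ -f * S.a - κ * S.b = 0) ∧
    (S.D₂ f + 2 * S.b * S.ω₁ - 2 * S.a * S.ω₂ = 0 ∧
      -f * (1 + S.c) + 2 * S.q * S.ω₁ + 2 * S.D₂ S.ω₂ + 2 * S.ω₂ ^ 2 + κ * S.d = 0) := by
  have hB (i j : Fin 4) : S.lap (rwedge S.e₁ S.e₂ i j) - l * rwedge S.e₁ S.e₂ i j =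
      f * rwedge S.e₁ S.e₂ i j - (S.ω₁ + S.ω₁) * rwedge S.H S.e₂ i j
        + (S.ω₂ + S.ω₂) * rwedge S.H S.e₁ i j - κ * rwedge S.H S.L i j := by
    rw [lap_gauss_map, hf, hκ]; ring
  have g₁ := S.wedge_coeff_eq_zero
    (α := S.D₁ f + 2 * S.a * S.ω₁ + 2 * S.b * S.ω₂)
    (β := f * S.d + 2 * S.p * S.ω₁ + 2 * S.D₁ S.ω₂ + 2 * S.ω₁ * S.ω₂ - κ * (1 - S.c))
    (γ := f * (1 - S.c) - 2 * S.D₁ S.ω₁ - 2 * S.ω₁ ^ 2 + 2 * S.p * S.ω₂ + κ * S.d)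
    (δ := f * S.b - κ * S.a) (ε := -f * S.a - κ * S.b)
    (ζ := 2 * S.b * S.ω₁ - 2 * S.a * S.ω₂ - S.D₁ κ) (fun i j => by
      have := h₁ i j
      rw [hB] at this
      simp only [rwedge, S.D₁H, S.D₁L, S.D₁e₁, S.D₁e₂, map_add, map_sub, Derivation.leibniz,
        smul_eq_mul, neg_mul] at this
      simp only [rwedge]
      linear_combination this)
  have g₂ := S.wedge_coeff_eq_zero
    (α := S.D₂ f + 2 * S.b * S.ω₁ - 2 * S.a * S.ω₂)
    (β := -f * (1 + S.c) + 2 * S.q * S.ω₁ + 2 * S.D₂ S.ω₂ + 2 * S.ω₂ ^ 2 + κ * S.d)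
    (γ := -f * S.d - 2 * S.D₂ S.ω₁ - 2 * S.ω₁ * S.ω₂ + 2 * S.q * S.ω₂ - κ * (1 + S.c))
    (δ := -f * S.a - κ * S.b) (ε := -f * S.b + κ * S.a)
    (ζ := -2 * S.a * S.ω₁ - 2 * S.b * S.ω₂ - S.D₂ κ) (fun i j => by
      have := h₂ i j
      rw [hB] at this
      simp only [rwedge, S.D₂H, S.D₂L, S.D₂e₁, S.D₂e₂, map_add, map_sub, Derivation.leibniz,
        smul_eq_mul, neg_mul] at this
      simp only [rwedge]
      linear_combination this)
  exact ⟨⟨g₁.1, g₁.2.2.1, g₁.2.2.2.1, g₁.2.2.2.2.1⟩, ⟨g₂.1, g₂.2.1⟩⟩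

/-- With a = b = 0 the direction of H is fixed. The unknown c cancels in the difference of the two
hypotheses, which is twice the eigenvalue equation for H. -/
lemma lap_H_of_flat {l : R} (ha : S.a = 0) (hb : S.b = 0)
    (h2 : IsUnit (2 : R))
    (h₁ : -l * (1 - S.c) - 2 * S.D₁ S.ω₁ - 2 * S.ω₁ ^ 2 + 2 * S.p * S.ω₂ = 0)
    (h₂ : l * (1 + S.c) + 2 * S.q * S.ω₁ + 2 * S.D₂ S.ω₂ + 2 * S.ω₂ ^ 2 = 0) (k : Fin 4) :
    S.lap (S.H k) = l * S.H k := by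
  apply h2.mul_left_cancel
  have e₁ (k : Fin 4) : S.D₁ (S.H k) = S.ω₁ * S.H k := by rw [S.D₁H, ha, hb]; ring
  have e₂ (k : Fin 4) : S.D₂ (S.H k) = S.ω₂ * S.H k := by rw [S.D₂H, ha, hb]; ring
  simp only [lap, e₁, e₂, Derivation.leibniz, smul_eq_mul]
  linear_combination S.H k * h₁ - S.H k * h₂

/-! ### The locus where the shape operator of H does not vanish -/

section Reduced

/-- Cancellation of r on the locus s ≠ 0: a factor r of s is invertible there. -/
lemma mul_eq_zero_of_mul_mul {A : Type*} [CommRing A] [IsReduced A] {r y s m : A}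
    (hs : s = r * m) (h : s * (r * y) = 0) : s * y = 0 := by
  have : (s * y) ^ 2 = 0 := by linear_combination s * y ^ 2 * hs + m * y * h
  exact pow_eq_zero_iff two_ne_zero |>.1 this

/-- Algebraic form of the fact that a function vanishing on the open set r ≠ 0 has vanishing
derivatives there. -/
lemma mul_derivation_eq_zero {A : Type*} [CommRing A] [Algebra ℝ A] [IsReduced A]
    (D : Derivation ℝ A A) {r y : A} (h : r * y = 0) : r * D y = 0 := by
  have := congrArg D h
  rw [Derivation.leibniz, map_zero, smul_eq_mul, smul_eq_mul] at this
  exact mul_eq_zero_of_mul_mul (m := 1) (by ring) (by linear_combination r * this - D r * h)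

variable {S}
variable [IsReduced R]

/-- On the open set `r = a² + b² ≠ 0`, a 1-type Gauss map gives `l = 0`. -/
lemma mul_eigenvalue_eq_zero {l f κ r : R} (h2 : IsUnit (2 : R)) (hl₁ : S.D₁ l = 0)
    (hl₂ : S.D₂ l = 0)
    (hf : f = -4 * (S.a * S.c + S.b * S.d) - l) (hκ : κ = 4 * (S.c * S.b - S.a * S.d))
    (hr : r = S.a ^ 2 + S.b ^ 2)
    (h₁ : S.D₁ f + 2 * S.a * S.ω₁ + 2 * S.b * S.ω₂ = 0)
    (h₂ : S.D₂ f + 2 * S.b * S.ω₁ - 2 * S.a * S.ω₂ = 0)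
    (h₃ : f * S.b - κ * S.a = 0) (h₄ : -f * S.a - κ * S.b = 0) : r * l = 0 := by
  have cancel_two {y : R} (h : r * (2 * y) = 0) : r * y = 0 :=
    h2.mul_left_cancel (by linear_combination h)
  -- `h₃` and `h₄` are a linear system in f, κ with determinant -(a² + b²) = -r.
  have rf : r * f = 0 := by rw [hr]; linear_combination S.b * h₃ - S.a * h₄
  have rκ : r * κ = 0 := by rw [hr]; linear_combination -S.a * h₃ - S.b * h₄
  have rf₁ := mul_derivation_eq_zero S.D₁ rf
  have rf₂ := mul_derivation_eq_zero S.D₂ rf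
  have rω₁ : r * S.ω₁ = 0 := mul_eq_zero_of_mul_mul (mul_one r).symm (cancel_two (by
    linear_combination (S.a * h₁ + S.b * h₂) * r - S.a * rf₁ - S.b * rf₂ + 2 * r * S.ω₁ * hr))
  have rω₂ : r * S.ω₂ = 0 := mul_eq_zero_of_mul_mul (mul_one r).symm (cancel_two (by
    linear_combination (S.b * h₁ - S.a * h₂) * r - S.b * rf₁ + S.a * rf₂ + 2 * r * S.ω₂ * hr))
  have H₁ := S.codazzi_H.1
  have H₂ := S.codazzi_H.2
  have L₁ := S.codazzi_L.1
  have L₂ := S.codazzi_L.2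
  set m := S.a * S.c + S.b * S.d with hm
  have hm' : S.D₁ S.q - S.D₂ S.p + S.p ^ 2 + S.q ^ 2 + 2 * m = 0 := by
    rw [hm]; linear_combination S.gauss
  -- Since f = -4m - l, the relation r f = 0 reads r l = -4 r m. From here on everything is
  -- multiplied by s = r m, so both r and m may be cancelled; the goal becomes s² = 0.
  suffices hs : r * m = 0 by rw [hf] at rf; linear_combination -rf - 4 * hs
  obtain ⟨s, hs⟩ : ∃ s, s = r * m := ⟨_, rfl⟩
  rw [← hs]
  have two {y : R} (h : s * (2 * y) = 0) : s * y = 0 :=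
    h2.mul_left_cancel (by linear_combination h)
  have cr {y : R} (h : s * (r * y) = 0) : s * y = 0 := mul_eq_zero_of_mul_mul hs h
  have cm {y : R} (h : s * (m * y) = 0) : s * y = 0 :=
    mul_eq_zero_of_mul_mul (hs.trans (mul_comm r m)) h
  have sω₁ : s * S.ω₁ = 0 := by rw [hs]; linear_combination m * rω₁
  have sω₂ : s * S.ω₂ = 0 := by rw [hs]; linear_combination m * rω₂
  have sf : s * (4 * m + l) = 0 := by rw [hf] at rf; rw [hs]; linear_combination -m * rf
  have four (D : Derivation ℝ R R) (hl : D l = 0) : s * D m = 0 := by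
    have e := mul_derivation_eq_zero D sf
    -- Sums in place of numerals keep derivatives of numerals out of the Leibniz rule; likewise p +
    -- p and q + q below.
    have h4 : (4 : R) * m = (m + m) + (m + m) := by ring
    rw [h4, map_add, map_add, map_add, hl] at e
    exact two (two (by linear_combination e))
  have m₁ := four S.D₁ hl₁
  have m₂ := four S.D₂ hl₂
  have sκ : s * (S.c * S.b - S.a * S.d) = 0 := two (two (by
    rw [hκ] at rκ; rw [hs]; linear_combination m * rκ))
  -- As bc = ad, the pair (c, d) equals (m/r)(a, b) where s ≠ 0.
  have sc : s * (r * S.c - S.a * m) = 0 := by rw [hr]; linear_combination S.b * sκ - s * S.a * hm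
  have sd : s * (r * S.d - S.b * m) = 0 := by rw [hr]; linear_combination -S.a * sκ - s * S.b * hm
  have sc₁ := mul_derivation_eq_zero S.D₁ sc
  have sc₂ := mul_derivation_eq_zero S.D₂ sc
  have sd₁ := mul_derivation_eq_zero S.D₁ sd
  have sd₂ := mul_derivation_eq_zero S.D₂ sd
  simp only [map_sub, Derivation.leibniz, smul_eq_mul] at sc₁ sc₂ sd₁ sd₂
  -- r times the Codazzi equation of L, compared with m times that of H: as m is constant and ω = 0
  -- here, only derivatives of r survive.
  have F₁ : s * (S.d * S.D₁ r - S.c * S.D₂ r) = 0 := by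
    linear_combination s * r * L₁ - sc₂ + sd₁ + 2 * S.p * sc + 2 * S.q * sd - m * s * H₁
      - S.a * m₂ + S.b * m₁ + (r * (1 - S.c) - m * S.a) * sω₂ + (r * S.d + m * S.b) * sω₁
  have F₂ : s * (S.c * S.D₁ r + S.d * S.D₂ r) = 0 := by
    linear_combination -s * r * L₂ + sc₁ + sd₂ - 2 * S.p * sd + 2 * S.q * sc + m * s * H₂
      + S.a * m₁ + S.b * m₂ + (r * S.d + m * S.b) * sω₂ + (r * (1 + S.c) + m * S.a) * sω₁
  -- The linear system `F₁`, `F₂` is solved using ac + bd = m and bc - ad = 0, so r is locally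
  -- constant.
  have r₁ : s * S.D₁ r = 0 := cm (by linear_combination S.b * F₁ + S.a * F₂ + S.D₂ r * sκ)
  have r₂ : s * S.D₂ r = 0 := cm (by linear_combination -S.a * F₁ + S.b * F₂ - S.D₁ r * sκ)
  have hD (D : Derivation ℝ R R) : D r = 2 * (S.a * D S.a + S.b * D S.b) := by
    rw [hr, pow_two, pow_two, map_add, Derivation.leibniz, Derivation.leibniz]
    simp only [smul_eq_mul]; ring
  rw [hD] at r₁ r₂
  have r₁ := two r₁
  have r₂ := two r₂
  have sH₁ : s * (-S.D₁ S.b + S.D₂ S.a - 2 * S.a * S.p - 2 * S.b * S.q) = 0 := by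
    linear_combination s * H₁ + S.a * sω₂ - S.b * sω₁
  have sH₂ : s * (S.D₁ S.a + S.D₂ S.b - 2 * S.b * S.p + 2 * S.a * S.q) = 0 := by
    linear_combination s * H₂ + S.b * sω₂ + S.a * sω₁
  -- Constancy of r and the Codazzi equations of H are four linear equations for the four first
  -- derivatives of a, b. Their solution says that (a, b) is parallel, rotating at twice the rate of
  -- the frame.
  have a₁ : s * (S.D₁ S.a - (S.p + S.p) * S.b) = 0 := cr (by
    linear_combination S.a * r₁ - S.b * r₂ + S.b ^ 2 * sH₂ + S.a * S.b * sH₁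
      + s * (S.D₁ S.a - 2 * S.p * S.b) * hr)
  have b₂ : s * (S.D₂ S.b + (S.q + S.q) * S.a) = 0 := by
    linear_combination sH₂ - a₁
  have b₁ : s * (S.D₁ S.b + (S.p + S.p) * S.a) = 0 := cr (by
    linear_combination S.b * r₁ + S.a * r₂ - S.a ^ 2 * sH₁ - S.a * S.b * sH₂
      + s * (S.D₁ S.b + 2 * S.p * S.a) * hr)
  have a₂ : s * (S.D₂ S.a - (S.q + S.q) * S.b) = 0 := by
    linear_combination sH₁ + b₁
  have A₁ := mul_derivation_eq_zero S.D₂ a₁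
  have A₂ := mul_derivation_eq_zero S.D₁ a₂
  have B₁ := mul_derivation_eq_zero S.D₂ b₁
  have B₂ := mul_derivation_eq_zero S.D₁ b₂
  simp only [map_sub, map_add, Derivation.leibniz, smul_eq_mul] at A₁ A₂ B₁ B₂
  -- Integrability of that rotation: the commutator on a, and then on b, produces twice the Gauss
  -- curvature times b, respectively a, up to sign.
  have ka : s * (S.b * (S.D₁ S.q - S.D₂ S.p + S.p ^ 2 + S.q ^ 2)) = 0 := two (by
    linear_combination A₁ - A₂ + s * S.comm S.a - S.p * a₁ - S.q * a₂ - 2 * S.q * b₁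
      + 2 * S.p * b₂)
  have kb : s * (S.a * (S.D₁ S.q - S.D₂ S.p + S.p ^ 2 + S.q ^ 2)) = 0 := two (by
    linear_combination B₂ - B₁ - s * S.comm S.b + S.p * b₁ + S.q * b₂ - 2 * S.q * a₁
      + 2 * S.p * a₂)
  have k : s * (S.D₁ S.q - S.D₂ S.p + S.p ^ 2 + S.q ^ 2) = 0 := cr (by
    linear_combination S.b * ka + S.a * kb
      + s * (S.D₁ S.q - S.D₂ S.p + S.p ^ 2 + S.q ^ 2) * hr)
  have sm : s * m = 0 := two (by linear_combination s * hm' - k)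
  have : s ^ 2 = 0 := by linear_combination s * hs + r * sm
  exact pow_eq_zero_iff two_ne_zero |>.1 this

end Reduced

end AdaptedFrame
end Algebra

/-! ### Construction of the adapted frame from an orthonormal tangent frame -/

section FrameConstruction

variable {R : Type*} [CommRing R]

lemma rmink_eq_mul (P : Matrix (Fin 4) (Fin 4) R) (i j : Fin 4) :
    (P * Matrix.diagonal (![-1, 1, 1, 1] : Fin 4 → R) * P.transpose : Matrix _ _ R) i j = rmink (P i) (P j) := by
  simp [Matrix.mul_apply, Fin.sum_univ_four, rmink, Matrix.diagonal_apply]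

/-- Expansion of a vector in a frame of two orthonormal and two dual null vectors. -/
lemma expand_null_frame {e₁ e₂ H L : Fin 4 → R} (h₁₁ : rmink e₁ e₁ = 1) (h₂₂ : rmink e₂ e₂ = 1)
    (h₁₂ : rmink e₁ e₂ = 0) (h₁H : rmink e₁ H = 0) (h₂H : rmink e₂ H = 0)
    (h₁L : rmink e₁ L = 0) (h₂L : rmink e₂ L = 0) (hHH : rmink H H = 0) (hLL : rmink L L = 0)
    (hHL : rmink H L = -1) (v : Fin 4 → R) (k : Fin 4) :
    v k = rmink v e₁ * e₁ k + rmink v e₂ * e₂ k - rmink v L * H k - rmink v H * L k := by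
  obtain ⟨P, p₀, p₁, p₂, p₃⟩ : ∃ P : Matrix (Fin 4) (Fin 4) R,
      P 0 = e₁ ∧ P 1 = e₂ ∧ P 2 = H ∧ P 3 = L := ⟨![e₁, e₂, H, L], rfl, rfl, rfl, rfl⟩
  set η : Matrix (Fin 4) (Fin 4) R := Matrix.diagonal ![-1, 1, 1, 1] with hη
  set G : Matrix (Fin 4) (Fin 4) R := !![1, 0, 0, 0; 0, 1, 0, 0; 0, 0, 0, -1; 0, 0, -1, 0] with hG
  -- The rows of P are the frame, so G is its Gram matrix. G is its own inverse, which makes P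
  -- invertible; moving the factors around yields Pᵀ G P η = 1, the claimed expansion.
  have hPG : P * η * P.transpose = G := by
    ext i j
    rw [hη, rmink_eq_mul]
    fin_cases i <;> fin_cases j <;>
      simp [p₀, p₁, p₂, p₃, hG, h₁₁, h₂₂, h₁₂, h₁H, h₂H, h₁L, h₂L, hHH, hLL, hHL, rmink_comm e₂ e₁,
        rmink_comm H e₁, rmink_comm H e₂, rmink_comm L e₁, rmink_comm L e₂, rmink_comm L H]
  have hGG : G * G = 1 := by
    ext i j
    fin_cases i <;> fin_cases j <;> simp [hG, Matrix.mul_apply, Fin.sum_univ_four]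
  have h₁ : P * (η * P.transpose * G) = 1 := by
    rw [← Matrix.mul_assoc, ← Matrix.mul_assoc, hPG, hGG]
  have h₂ : (P.transpose * G * P) * η = 1 := by
    have h₃ := mul_eq_one_comm.1 h₁
    rw [Matrix.mul_assoc, Matrix.mul_assoc] at h₃
    rw [Matrix.mul_assoc P.transpose]
    exact mul_eq_one_comm.1 h₃
  have h₄ := congrFun (congrArg (fun A => A.mulVec v) h₂) k
  simp only [Matrix.one_mulVec] at h₄
  rw [← h₄]
  simp only [Matrix.mulVec, dotProduct, Fin.sum_univ_four, Matrix.mul_apply, p₀, p₁, p₂, p₃, hG,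
    hη, Matrix.diagonal_apply, Matrix.transpose_apply]
  simp [rmink]
  ring

variable [Algebra ℝ R]

lemma derivation_rmink (D : Derivation ℝ R R) (v w : Fin 4 → R) :
    D (rmink v w) = rmink (fun k => D (v k)) w + rmink v (fun k => D (w k)) := by
  simp only [rmink, map_add, map_neg, Derivation.leibniz, smul_eq_mul]; ring

lemma derivation_rmink_const (D : Derivation ℝ R R) {v w : Fin 4 → R} {t : ℝ}
    (h : rmink v w = algebraMap ℝ R t) :
    rmink (fun k => D (v k)) w = -rmink (fun k => D (w k)) v := by
  have := derivation_rmink D v w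
  rw [h, Derivation.map_algebraMap, rmink_comm v] at this
  linear_combination -this

lemma isUnit_two_of_algebra : IsUnit (2 : R) := by
  have : (2 : R) = algebraMap ℝ R 2 := (map_ofNat _ 2).symm
  rw [this]; exact (isUnit_iff_ne_zero.2 two_ne_zero).map _

lemma derivation_rmink_self (D : Derivation ℝ R R) {v : Fin 4 → R} {t : ℝ}
    (h : rmink v v = algebraMap ℝ R t) : rmink (fun k => D (v k)) v = 0 :=
  isUnit_two_of_algebra.mul_left_cancel (by linear_combination derivation_rmink_const D h)

/-- The null normal dual to a light-like normal vector with invertible time component. -/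
lemma exists_dual_null {e₁ e₂ H : Fin 4 → R} (h₁₁ : rmink e₁ e₁ = 1)
    (h₂₂ : rmink e₂ e₂ = 1) (h₁₂ : rmink e₁ e₂ = 0) (h₁H : rmink e₁ H = 0) (h₂H : rmink e₂ H = 0)
    (hHH : rmink H H = 0) (hH : IsUnit (H 0)) :
    ∃ L, rmink e₁ L = 0 ∧ rmink e₂ L = 0 ∧ rmink L L = 0 ∧ rmink H L = -1 := by
  obtain ⟨w, hw⟩ := hH.exists_right_inv
  obtain ⟨t, ht⟩ := (isUnit_two_of_algebra (R := R)).exists_right_inv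
  have comb (α β : R) (A B C : Fin 4 → R) :
      rmink C (fun k => α * A k + β * B k) = α * rmink C A + β * rmink C B := by
    simp only [rmink]; ring
  have hT (v : Fin 4 → R) : rmink v (fun k => ![1, 0, 0, 0] k + e₁ 0 * e₁ k + e₂ 0 * e₂ k) =
      -v 0 + e₁ 0 * rmink v e₁ + e₂ 0 * rmink v e₂ := by
    simp [rmink]; ring
  -- The normal projection of the time axis, for which ⟨H, T⟩ = -H⁰ is a unit.
  set T : Fin 4 → R := fun k => ![1, 0, 0, 0] k + e₁ 0 * e₁ k + e₂ 0 * e₂ k with hTdef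
  have h₁T : rmink e₁ T = 0 := by rw [hT, h₁₁, h₁₂]; ring
  have h₂T : rmink e₂ T = 0 := by rw [hT, h₂₂, rmink_comm, h₁₂]; ring
  have hHT : rmink H T = -H 0 := by rw [hT, rmink_comm, h₁H, rmink_comm, h₂H]; ring
  -- With w = 1/H⁰ and t = 1/2, the first term normalizes ⟨H, L⟩ and the multiple of H makes L null.
  refine ⟨fun k => w * T k + t * w ^ 2 * rmink T T * H k, ?_, ?_, ?_, ?_⟩
  · rw [comb, h₁T, h₁H]; ring
  · rw [comb, h₂T, h₂H]; ring
  · rw [comb, rmink_comm _ T, comb, rmink_comm T H, rmink_comm _ H, comb, hHT, hHH]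
    linear_combination -2 * t * w ^ 2 * rmink T T * hw - w ^ 2 * rmink T T * ht
  · rw [comb, hHT, hHH]; linear_combination -hw

/-- The adapted frame of a marginally trapped surface with a given orthonormal tangent frame. -/
theorem exists_adaptedFrame (D₁ D₂ : Derivation ℝ R R) {e₁ e₂ H : Fin 4 → R} {p q : R}
    (h₁₁ : rmink e₁ e₁ = 1) (h₂₂ : rmink e₂ e₂ = 1) (h₁₂ : rmink e₁ e₂ = 0)
    (hp : rmink (fun k => D₁ (e₁ k)) e₂ = p) (hq : rmink (fun k => D₂ (e₁ k)) e₂ = q)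
    (comm : ∀ f, D₁ (D₂ f) - D₂ (D₁ f) = -p * D₁ f - q * D₂ f)
    (hsymm : ∀ k, D₁ (e₂ k) - D₂ (e₁ k) = -p * e₁ k - q * e₂ k)
    (hH : ∀ k, 2 * H k = D₁ (e₁ k) + D₂ (e₂ k) - p * e₂ k + q * e₁ k)
    (hHH : rmink H H = 0) (hH₀ : IsUnit (H 0)) :
    ∃ S : AdaptedFrame R, S.D₁ = D₁ ∧ S.D₂ = D₂ ∧ S.e₁ = e₁ ∧ S.e₂ = e₂ ∧ S.H = H ∧
      S.p = p ∧ S.q = q := by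
  have u2 : IsUnit (2 : R) := isUnit_two_of_algebra
  have one' {v w : Fin 4 → R} (h : rmink v w = 1) : rmink v w = algebraMap ℝ R 1 := by simp [h]
  have zero' {v w : Fin 4 → R} (h : rmink v w = 0) : rmink v w = algebraMap ℝ R 0 := by simp [h]
  have s₁ := derivation_rmink_self D₁ (one' h₁₁)
  have s₂ := derivation_rmink_self D₂ (one' h₁₁)
  have s₃ := derivation_rmink_self D₁ (one' h₂₂)
  have s₄ := derivation_rmink_self D₂ (one' h₂₂)
  have t₁ := derivation_rmink_const D₁ (zero' h₁₂)
  have t₂ := derivation_rmink_const D₂ (zero' h₁₂)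
  have h₂₁ := (rmink_comm e₂ e₁).trans h₁₂
  have tr (w : Fin 4 → R) : 2 * rmink H w = rmink (fun k => D₁ (e₁ k)) w +
      rmink (fun k => D₂ (e₂ k)) w - p * rmink e₂ w + q * rmink e₁ w := by
    simp only [rmink]
    linear_combination -w 0 * hH 0 + w 1 * hH 1 + w 2 * hH 2 + w 3 * hH 3
  have sy (w : Fin 4 → R) : rmink (fun k => D₁ (e₂ k)) w = rmink (fun k => D₂ (e₁ k)) w
      - p * rmink e₁ w - q * rmink e₂ w := by
    simp only [rmink]
    linear_combination -w 0 * hsymm 0 + w 1 * hsymm 1 + w 2 * hsymm 2 + w 3 * hsymm 3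
  have h₁H : rmink e₁ H = 0 := u2.mul_left_cancel (by
    rw [rmink_comm, tr, s₁, h₁₁, h₂₁]; linear_combination t₂ - hq)
  have h₂H : rmink e₂ H = 0 := u2.mul_left_cancel (by
    rw [rmink_comm, tr, s₄, h₁₂, h₂₂]; linear_combination hp)
  obtain ⟨L, h₁L, h₂L, hLL, hHL⟩ := exists_dual_null h₁₁ h₂₂ h₁₂ h₁H h₂H hHH hH₀
  have neg' : rmink H L = algebraMap ℝ R (-1) := by simp [hHL]
  have ex := expand_null_frame h₁₁ h₂₂ h₁₂ h₁H h₂H h₁L h₂L hHH hLL hHL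
  have trH := tr H
  have trL := tr L
  rw [hHH, h₁H, h₂H] at trH
  rw [hHL, h₁L, h₂L] at trL
  have syH := sy H
  have syL := sy L
  rw [h₁H, h₂H] at syH
  rw [h₁L, h₂L] at syL
  have H₁ := derivation_rmink_self D₁ (zero' hHH)
  have H₂ := derivation_rmink_self D₂ (zero' hHH)
  have L₁ := derivation_rmink_self D₁ (zero' hLL)
  have L₂ := derivation_rmink_self D₂ (zero' hLL)
  have HL₁ := derivation_rmink_const D₁ neg'
  have HL₂ := derivation_rmink_const D₂ neg'
  have a₁ := derivation_rmink_const D₁ (zero' h₁H)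
  have a₂ := derivation_rmink_const D₂ (zero' h₁H)
  have b₁ := derivation_rmink_const D₁ (zero' h₂H)
  have b₂ := derivation_rmink_const D₂ (zero' h₂H)
  have c₁ := derivation_rmink_const D₁ (zero' h₁L)
  have c₂ := derivation_rmink_const D₂ (zero' h₁L)
  have d₁ := derivation_rmink_const D₁ (zero' h₂L)
  have d₂ := derivation_rmink_const D₂ (zero' h₂L)
  refine ⟨{ D₁ := D₁, D₂ := D₂, e₁ := e₁, e₂ := e₂, H := H, L := L, p := p, q := q
            a := rmink (fun k => D₁ (e₁ k)) H
            b := rmink (fun k => D₂ (e₁ k)) H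
            c := 1 + rmink (fun k => D₁ (e₁ k)) L
            d := rmink (fun k => D₂ (e₁ k)) L
            ω₁ := -rmink (fun k => D₁ (H k)) L
            ω₂ := -rmink (fun k => D₂ (H k)) L
            e₁e₁ := h₁₁, e₂e₂ := h₂₂, e₁e₂ := h₁₂, e₁H := h₁H, e₂H := h₂H, e₁L := h₁L
            e₂L := h₂L, HH := hHH, LL := hLL, HL := hHL, comm := comm
            D₁e₁ := ?_, D₂e₁ := ?_, D₁e₂ := ?_, D₂e₂ := ?_
            D₁H := ?_, D₂H := ?_, D₁L := ?_, D₂L := ?_ }, rfl, rfl, rfl, rfl, rfl, rfl, rfl⟩ <;>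
    intro k
  · linear_combination ex (fun k => D₁ (e₁ k)) k + e₁ k * s₁ + e₂ k * hp
  · linear_combination ex (fun k => D₂ (e₁ k)) k + e₁ k * s₂ + e₂ k * hq
  · linear_combination ex (fun k => D₁ (e₂ k)) k + e₂ k * s₃ + e₁ k * (t₁ - hp) - H k * syL
      - L k * syH
  · linear_combination ex (fun k => D₂ (e₂ k)) k + e₂ k * s₄ + e₁ k * (t₂ - hq) + H k * trL
      + L k * trH
  · linear_combination ex (fun k => D₁ (H k)) k + e₁ k * a₁ + e₂ k * (b₁ - syH) - L k * H₁
  · linear_combination ex (fun k => D₂ (H k)) k + e₁ k * a₂ + e₂ k * (b₂ + trH) - L k * H₂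
  · linear_combination ex (fun k => D₁ (L k)) k + e₁ k * c₁ + e₂ k * (d₁ - syL) - H k * L₁
      - L k * HL₁
  · linear_combination ex (fun k => D₂ (L k)) k + e₁ k * c₂ + e₂ k * (d₂ + trL) - H k * L₂
      - L k * HL₂

end FrameConstruction

/-! ### The eigenvalue equation for H in an adapted frame -/

section OneType

variable {R : Type*} [CommRing R] [Algebra ℝ R] (S : AdaptedFrame R)

/-- If the Gauss map is of 1-type with non-zero eigenvalue, the mean curvature vector is an
eigenvector of the Laplacian. -/
theorem AdaptedFrame.lap_H [IsReduced R] (hR : ∀ a b : R, a ^ 2 + b ^ 2 = 0 → a = 0)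
    {lam : ℝ} (hlam : lam ≠ 0)
    (h₁ : ∀ i j, S.D₁ (S.lap (rwedge S.e₁ S.e₂ i j)
      - algebraMap ℝ R lam * rwedge S.e₁ S.e₂ i j) = 0)
    (h₂ : ∀ i j, S.D₂ (S.lap (rwedge S.e₁ S.e₂ i j)
      - algebraMap ℝ R lam * rwedge S.e₁ S.e₂ i j) = 0) (k : Fin 4) :
    S.lap (S.H k) = algebraMap ℝ R lam * S.H k := by
  obtain ⟨⟨k₁, k₂, k₃, k₄⟩, k₅, k₆⟩ := S.components_of_one_type h₁ h₂ rfl rfl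
  have hr := AdaptedFrame.mul_eigenvalue_eq_zero isUnit_two_of_algebra
    (Derivation.map_algebraMap _ _) (Derivation.map_algebraMap _ _) rfl rfl rfl k₁ k₅ k₃ k₄
  have hr : S.a ^ 2 + S.b ^ 2 = 0 :=
    ((isUnit_iff_ne_zero.2 hlam).map (algebraMap ℝ R)).mul_right_cancel (by rw [hr, zero_mul])
  have ha := hR _ _ hr
  have hb := hR _ _ ((add_comm _ _).trans hr)
  simp only [ha, hb] at k₂ k₆
  exact S.lap_H_of_flat ha hb isUnit_two_of_algebra (by linear_combination k₂)
    (by linear_combination k₆) k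

end OneType

/-! ### The coordinate Laplacian in an orthonormal basis -/

section PointwiseLaplacian

variable {F : Type*} [NormedAddCommGroup F] [NormedSpace ℝ F]

lemma mink_comm (v w : Mink4) : mink v w = mink w v := by simp only [mink]; ring

lemma mink_add_left (v v' w : Mink4) : mink (v + v') w = mink v w + mink v' w := by
  simp only [mink, Pi.add_apply]; ring

lemma mink_add_right (v w w' : Mink4) : mink v (w + w') = mink v w + mink v w' := by
  simp only [mink, Pi.add_apply]; ring

lemma mink_smul_left (c : ℝ) (v w : Mink4) : mink (c • v) w = c * mink v w := by
  simp only [mink, Pi.smul_apply, smul_eq_mul]; ring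

lemma mink_smul_right (c : ℝ) (v w : Mink4) : mink v (c • w) = c * mink v w := by
  simp only [mink, Pi.smul_apply, smul_eq_mul]; ring

lemma fderiv_mink {v w : Plane → Mink4} {u : Plane} (hv : DifferentiableAt ℝ v u)
    (hw : DifferentiableAt ℝ w u) (z : Plane) :
    fderiv ℝ (fun y => mink (v y) (w y)) u z =
      mink (fderiv ℝ v u z) (w u) + mink (v u) (fderiv ℝ w u z) := by
  have hv' k := hasFDerivAt_pi'.1 hv.hasFDerivAt k
  have hw' k := hasFDerivAt_pi'.1 hw.hasFDerivAt k
  have h := ((((hv' 0).mul (hw' 0)).neg.add ((hv' 1).mul (hw' 1))).add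
    ((hv' 2).mul (hw' 2))).add ((hv' 3).mul (hw' 3))
  have h' : HasFDerivAt (fun y => mink (v y) (w y)) _ u := h
  rw [h'.fderiv]
  simp [mink]
  ring

lemma differentiableAt_fderiv {f : Plane → F} {u : Plane} (hf : ContDiffAt ℝ 2 f u) :
    DifferentiableAt ℝ (fderiv ℝ f) u :=
  (hf.fderiv_right (m := 1) (by norm_num)).differentiableAt (by norm_num)

lemma fderiv_fderiv_symm {f : Plane → F} {u : Plane} (hf : ContDiffAt ℝ 2 f u) (v w : Plane) :
    fderiv ℝ (fderiv ℝ f) u v w = fderiv ℝ (fderiv ℝ f) u w v :=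
  hf.isSymmSndFDerivAt (by simp) v w

lemma fderiv_fderiv_apply {f : Plane → F} {u : Plane} (hf : ContDiffAt ℝ 2 f u)
    {E : Plane → Plane} (hE : DifferentiableAt ℝ E u) (z : Plane) :
    fderiv ℝ (fun y => fderiv ℝ f y (E y)) u z =
      fderiv ℝ (fderiv ℝ f) u z (E u) + fderiv ℝ f u (fderiv ℝ E u z) := by
  rw [fderiv_clm_apply (differentiableAt_fderiv hf) hE]
  simp [add_comm]

lemma pd_pd {f : Plane → F} {u : Plane} (hf : ContDiffAt ℝ 2 f u) (i j : Fin 2) :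
    pd i (pd j f) u =
      fderiv ℝ (fderiv ℝ f) u (EuclideanSpace.single i 1) (EuclideanSpace.single j 1) := by
  have := fderiv_fderiv_apply hf (E := fun _ => EuclideanSpace.single j 1)
    (differentiableAt_const _) (EuclideanSpace.single i 1)
  rw [fderiv_const_apply, zero_apply, map_zero, add_zero] at this
  exact this

lemma pd_metric {X : Plane → Mink4} {u : Plane} (hX : ContDiffAt ℝ 2 X u) (i j l : Fin 2) :
    pd i (fun y => metric X y j l) u =
      mink (pd i (pd j X) u) (pd l X u) + mink (pd j X u) (pd i (pd l X) u) := by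
  have hd (j : Fin 2) : DifferentiableAt ℝ (pd j X) u :=
    (differentiableAt_fderiv hX).clm_apply (differentiableAt_const _)
  exact fderiv_mink (hd j) (hd l) _

/-- For an induced metric the Koszul combination collapses by symmetry of second derivatives: the
Levi-Civita connection is the tangential part of the flat one. -/
lemma christoffel_eq {X : Plane → Mink4} {u : Plane} (hX : ContDiffAt ℝ 2 X u) (k i j : Fin 2) :
    christoffel X u k i j = ∑ l, (metric X u)⁻¹ k l * mink (pd i (pd j X) u) (pd l X u) := by
  rw [christoffel, Finset.mul_sum]
  refine Finset.sum_congr rfl fun l _ => ?_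
  have hs (i j : Fin 2) : pd i (pd j X) u = pd j (pd i X) u := by
    rw [pd_pd hX, pd_pd hX, fderiv_fderiv_symm hX]
  rw [pd_metric hX, pd_metric hX, pd_metric hX, hs j i, hs l i, hs l j,
    mink_comm (pd j X u), mink_comm (pd i X u)]
  ring

/-- `v₁, v₂` is an orthonormal basis of the coordinate plane for the metric induced by `X`. -/
structure IsOrthonormalAt (X : Plane → Mink4) (u v₁ v₂ : Plane) : Prop where
  fst : mink (fderiv ℝ X u v₁) (fderiv ℝ X u v₁) = 1
  snd : mink (fderiv ℝ X u v₂) (fderiv ℝ X u v₂) = 1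
  cross : mink (fderiv ℝ X u v₁) (fderiv ℝ X u v₂) = 0

lemma eq_combination (v : Plane) :
    v = v 0 • EuclideanSpace.single 0 1 + v 1 • EuclideanSpace.single 1 1 := by
  ext i; fin_cases i <;> simp

lemma clm_apply (A : Plane →L[ℝ] F) (v : Plane) :
    A v = v 0 • A (EuclideanSpace.single 0 1) + v 1 • A (EuclideanSpace.single 1 1) := by
  conv_lhs => rw [eq_combination v]
  rw [map_add, map_smul, map_smul]

lemma clm_apply_self (B : Plane →L[ℝ] Plane →L[ℝ] F) (v : Plane) :
    B v v = v 0 • (v 0 • B (EuclideanSpace.single 0 1) (EuclideanSpace.single 0 1)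
      + v 1 • B (EuclideanSpace.single 0 1) (EuclideanSpace.single 1 1))
      + v 1 • (v 0 • B (EuclideanSpace.single 1 1) (EuclideanSpace.single 0 1)
      + v 1 • B (EuclideanSpace.single 1 1) (EuclideanSpace.single 1 1)) := by
  rw [clm_apply (B v) v, clm_apply B v]
  simp only [add_apply, smul_apply]
  module

namespace IsOrthonormalAt

variable {X : Plane → Mink4} {u v₁ v₂ : Plane}

/-- With V having rows v₁, v₂, orthonormality is V g Vᵀ = 1, hence g (Vᵀ V) = 1. -/
lemma metric_mul (h : IsOrthonormalAt X u v₁ v₂) :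
    metric X u * Matrix.of (fun i j => v₁ i * v₁ j + v₂ i * v₂ j) = 1 := by
  set V : Matrix (Fin 2) (Fin 2) ℝ := Matrix.of ![⇑v₁, ⇑v₂] with hV
  have key (v w : Plane) : mink (fderiv ℝ X u v) (fderiv ℝ X u w) =
      ∑ i, ∑ j, v i * (metric X u i j * w j) := by
    conv_lhs => rw [eq_combination v, eq_combination w]
    simp only [map_add, map_smul, mink_add_left, mink_add_right, mink_smul_left, mink_smul_right,
      Fin.sum_univ_two, metric, pd, Matrix.of_apply]
    ring
  have h₁ : V * (metric X u * V.transpose) = 1 := by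
    have h₁ := h.fst
    have h₂ := h.snd
    have h₃ := h.cross
    have h₄ := (mink_comm _ _).trans h.cross
    rw [key] at h₁ h₂ h₃ h₄
    ext i j
    fin_cases i <;> fin_cases j <;>
      simp [Matrix.mul_apply, Fin.sum_univ_two, hV] <;>
      simp [Fin.sum_univ_two] at h₁ h₂ h₃ h₄ <;> linarith
  have h₂ : V.transpose * V = Matrix.of (fun i j => v₁ i * v₁ j + v₂ i * v₂ j) := by
    ext i j
    simp [Matrix.mul_apply, Fin.sum_univ_two, hV]
  rw [← h₂, ← Matrix.mul_assoc]
  exact mul_eq_one_comm.1 h₁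

lemma inv_metric (h : IsOrthonormalAt X u v₁ v₂) (i j : Fin 2) :
    (metric X u)⁻¹ i j = v₁ i * v₁ j + v₂ i * v₂ j := by
  rw [Matrix.inv_eq_right_inv h.metric_mul]; rfl

lemma expand (h : IsOrthonormalAt X u v₁ v₂) (z : Plane) :
    z = mink (fderiv ℝ X u z) (fderiv ℝ X u v₁) • v₁
      + mink (fderiv ℝ X u z) (fderiv ℝ X u v₂) • v₂ := by
  have e (i j : Fin 2) := congrArg (fun A : Matrix (Fin 2) (Fin 2) ℝ => A i j)
    (mul_eq_one_comm.1 h.metric_mul)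
  have key (v w : Plane) : mink (fderiv ℝ X u v) (fderiv ℝ X u w) =
      ∑ i, ∑ j, w i * (metric X u i j * v j) := by
    rw [mink_comm]
    conv_lhs => rw [eq_combination v, eq_combination w]
    simp only [map_add, map_smul, mink_add_left, mink_add_right, mink_smul_left, mink_smul_right,
      Fin.sum_univ_two, metric, pd, Matrix.of_apply]
    ring
  ext k
  have e₀ := e k 0
  have e₁ := e k 1
  simp only [Matrix.mul_apply, Fin.sum_univ_two, Matrix.of_apply] at e₀ e₁
  simp only [PiLp.add_apply, PiLp.smul_apply, smul_eq_mul, key, Fin.sum_univ_two]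
  have e₂ : ∀ k, z k = (1 : Matrix (Fin 2) (Fin 2) ℝ) k 0 * z 0
      + (1 : Matrix (Fin 2) (Fin 2) ℝ) k 1 * z 1 :=
    Fin.forall_fin_two.2 ⟨by simp, by simp⟩
  rw [e₂]
  linear_combination -z 0 * e₀ - z 1 * e₁

/-- The Laplacian in terms of an orthonormal basis. -/
theorem coordLaplacian_eq (h : IsOrthonormalAt X u v₁ v₂) (hX : ContDiffAt ℝ 2 X u)
    {f : Plane → F} (hf : ContDiffAt ℝ 2 f u) :
    coordLaplacian X f u =
      -(fderiv ℝ (fderiv ℝ f) u v₁ v₁ + fderiv ℝ (fderiv ℝ f) u v₂ v₂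
        - mink (fderiv ℝ (fderiv ℝ X) u v₁ v₁ + fderiv ℝ (fderiv ℝ X) u v₂ v₂)
            (fderiv ℝ X u v₁) • fderiv ℝ f u v₁
        - mink (fderiv ℝ (fderiv ℝ X) u v₁ v₁ + fderiv ℝ (fderiv ℝ X) u v₂ v₂)
            (fderiv ℝ X u v₂) • fderiv ℝ f u v₂) := by
  rw [clm_apply_self _ v₁, clm_apply_self _ v₂, clm_apply_self _ v₁, clm_apply_self _ v₂,
    clm_apply _ v₁, clm_apply _ v₁, clm_apply _ v₂, clm_apply _ v₂]
  simp only [coordLaplacian, christoffel_eq hX, h.inv_metric, Fin.sum_univ_two, pd_pd hX,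
    pd_pd hf, mink_add_left, mink_add_right, mink_smul_left, mink_smul_right]
  simp only [pd]
  module

end IsOrthonormalAt

end PointwiseLaplacian

/-! ### Locality, linearity and coordinate invariance of the Laplacian -/

section LaplacianProperties

variable {F : Type*} [NormedAddCommGroup F] [NormedSpace ℝ F]
  {G : Type*} [NormedAddCommGroup G] [NormedSpace ℝ G]
  {X Y : Plane → Mink4} {f g : Plane → F} {u v₁ v₂ : Plane}

lemma coordLaplacian_congr (h : IsOrthonormalAt X u v₁ v₂) (hX : ContDiffAt ℝ 2 X u)
    (hf : ContDiffAt ℝ 2 f u) (hY : Y =ᶠ[nhds u] X) (hg : g =ᶠ[nhds u] f) :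
    coordLaplacian Y g u = coordLaplacian X f u := by
  have h' : IsOrthonormalAt Y u v₁ v₂ := by
    constructor <;> rw [hY.fderiv_eq]
    exacts [h.fst, h.snd, h.cross]
  rw [h.coordLaplacian_eq hX hf, h'.coordLaplacian_eq (hX.congr_of_eventuallyEq hY)
    (hf.congr_of_eventuallyEq hg), hY.fderiv_eq, hg.fderiv_eq, hY.fderiv.fderiv_eq,
    hg.fderiv.fderiv_eq]

lemma fderiv_fderiv_clm_comp (A : F →L[ℝ] G) (hf : ContDiffAt ℝ 2 f u) :
    (∀ v, fderiv ℝ (fun y => A (f y)) u v = A (fderiv ℝ f u v)) ∧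
    ∀ v w, fderiv ℝ (fderiv ℝ (fun y => A (f y))) u v w = A (fderiv ℝ (fderiv ℝ f) u v w) := by
  have h₁ : ∀ᶠ y in nhds u, fderiv ℝ (fun y => A (f y)) y = A.comp (fderiv ℝ f y) := by
    filter_upwards [hf.eventually (by simp)] with y hy
    exact (A.hasFDerivAt.comp y (hy.differentiableAt (by simp)).hasFDerivAt).fderiv
  refine ⟨fun v => by rw [h₁.self_of_nhds]; rfl, fun v w => ?_⟩
  have h₂ := (A.hasFDerivAt.comp u
    ((differentiableAt_fderiv hf).clm_apply (differentiableAt_const w)).hasFDerivAt).fderiv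
  have h₃ : (fun y => fderiv ℝ (fun y => A (f y)) y w) =ᶠ[nhds u] A ∘ fun y => fderiv ℝ f y w := by
    filter_upwards [h₁] with y hy
    rw [hy]; rfl
  have e₁ := fderiv_fderiv_apply (A.contDiff.contDiffAt.comp u hf) (differentiableAt_const w) v
  have e₂ := fderiv_fderiv_apply hf (differentiableAt_const w) v
  rw [fderiv_const_apply, zero_apply, map_zero, add_zero] at e₁ e₂
  rw [← e₂]
  refine e₁.symm.trans ?_
  have h₄ := h₃.fderiv_eq (𝕜 := ℝ)
  rw [h₂] at h₄
  exact congrArg (fun B : Plane →L[ℝ] G => B v) h₄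

lemma coordLaplacian_clm_comp (h : IsOrthonormalAt X u v₁ v₂) (hX : ContDiffAt ℝ 2 X u)
    (A : F →L[ℝ] G) (hf : ContDiffAt ℝ 2 f u) :
    coordLaplacian X (fun y => A (f y)) u = A (coordLaplacian X f u) := by
  have hA := fderiv_fderiv_clm_comp A hf
  have hf' : ContDiffAt ℝ 2 (fun y => A (f y)) u := A.contDiff.contDiffAt.comp u hf
  rw [h.coordLaplacian_eq hX hf, h.coordLaplacian_eq hX hf']
  simp only [hA.1, hA.2, map_neg, map_sub, map_add, map_smul]

lemma coordLaplacian_sub (h : IsOrthonormalAt X u v₁ v₂) (hX : ContDiffAt ℝ 2 X u)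
    (hf : ContDiffAt ℝ 2 f u) (hg : ContDiffAt ℝ 2 g u) :
    coordLaplacian X (fun y => f y - g y) u = coordLaplacian X f u - coordLaplacian X g u := by
  -- The difference is a continuous linear map applied to the pair (f, g).
  have h₁ := coordLaplacian_clm_comp h hX
    (ContinuousLinearMap.fst ℝ F F - ContinuousLinearMap.snd ℝ F F) (hf.prodMk hg)
  have h₂ := coordLaplacian_clm_comp h hX (ContinuousLinearMap.fst ℝ F F) (hf.prodMk hg)
  have h₃ := coordLaplacian_clm_comp h hX (ContinuousLinearMap.snd ℝ F F) (hf.prodMk hg)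
  simp only [sub_apply, ContinuousLinearMap.coe_fst', ContinuousLinearMap.coe_snd'] at h₁ h₂ h₃
  rw [h₁, ← h₂, ← h₃]

lemma coordLaplacian_const (c : F) : coordLaplacian X (fun _ => c) u = 0 := by
  have h (i : Fin 2) : pd i (fun _ : Plane => c) = fun _ => 0 := by ext; simp [pd]
  have h' (i : Fin 2) : pd i (fun _ : Plane => (0 : F)) u = 0 := by simp [pd]
  simp [coordLaplacian, h, h']

lemma fderiv_fderiv_comp {T : Plane → Plane} (hT : ContDiffAt ℝ 2 T u)
    (hf : ContDiffAt ℝ 2 f (T u)) :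
    (∀ v, fderiv ℝ (f ∘ T) u v = fderiv ℝ f (T u) (fderiv ℝ T u v)) ∧
    ∀ v, fderiv ℝ (fderiv ℝ (f ∘ T)) u v v =
      fderiv ℝ (fderiv ℝ f) (T u) (fderiv ℝ T u v) (fderiv ℝ T u v)
        + fderiv ℝ f (T u) (fderiv ℝ (fderiv ℝ T) u v v) := by
  have h₁ : ∀ᶠ y in nhds u, fderiv ℝ (f ∘ T) y = (fderiv ℝ f (T y)).comp (fderiv ℝ T y) := by
    filter_upwards [hT.eventually (by simp),
      hT.continuousAt.eventually (hf.eventually (by simp))] with y hy hy'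
    exact fderiv_comp y (hy'.differentiableAt (by simp)) (hy.differentiableAt (by simp))
  refine ⟨fun v => by rw [h₁.self_of_nhds]; rfl, fun v => ?_⟩
  have hdf : HasFDerivAt (fun y => fderiv ℝ f (T y))
      ((fderiv ℝ (fderiv ℝ f) (T u)).comp (fderiv ℝ T u)) u :=
    (differentiableAt_fderiv hf).hasFDerivAt.comp u (hT.differentiableAt (by simp)).hasFDerivAt
  have hdT : DifferentiableAt ℝ (fun y => fderiv ℝ T y v) u :=
    (differentiableAt_fderiv hT).clm_apply (differentiableAt_const v)
  have h₃ : (fun y => fderiv ℝ (f ∘ T) y v) =ᶠ[nhds u]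
      fun y => fderiv ℝ f (T y) (fderiv ℝ T y v) := by
    filter_upwards [h₁] with y hy
    rw [hy]; rfl
  have e₁ := fderiv_fderiv_apply (hf.comp u hT) (differentiableAt_const v) v
  have e₂ := fderiv_fderiv_apply hT (differentiableAt_const v) v
  rw [fderiv_const_apply, zero_apply, map_zero, add_zero] at e₁ e₂
  rw [← e₂, ← e₁, h₃.fderiv_eq, fderiv_clm_apply hdf.differentiableAt hdT, hdf.fderiv]
  simp [add_comm]

lemma IsOrthonormalAt.of_comp {T : Plane → Plane} (h : IsOrthonormalAt (X ∘ T) u v₁ v₂)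
    (hT : ContDiffAt ℝ 2 T u) (hX : ContDiffAt ℝ 2 X (T u)) :
    IsOrthonormalAt X (T u) (fderiv ℝ T u v₁) (fderiv ℝ T u v₂) := by
  have hd := (fderiv_fderiv_comp hT hX).1
  constructor <;> simp only [← hd]
  exacts [h.fst, h.snd, h.cross]

/-- The Laplacian is independent of coordinates. -/
theorem coordLaplacian_comp {T : Plane → Plane} (h : IsOrthonormalAt (X ∘ T) u v₁ v₂)
    (hT : ContDiffAt ℝ 2 T u) (hX : ContDiffAt ℝ 2 X (T u)) (hf : ContDiffAt ℝ 2 f (T u)) :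
    coordLaplacian (X ∘ T) (f ∘ T) u = coordLaplacian X f (T u) := by
  have h' := h.of_comp hT hX
  have dX := fderiv_fderiv_comp hT hX
  have df := fderiv_fderiv_comp hT hf
  rw [h.coordLaplacian_eq (hX.comp u hT) (hf.comp u hT), h'.coordLaplacian_eq hX hf]
  -- The second derivative of T enters through that of f and through the tangential part of that of
  -- X; expanded in the new basis, the two contributions cancel.
  have ex := h'.expand (fderiv ℝ (fderiv ℝ T) u v₁ v₁ + fderiv ℝ (fderiv ℝ T) u v₂ v₂)
  have ef := congrArg (fderiv ℝ f (T u)) ex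
  simp only [dX.1, dX.2, df.1, df.2]
  simp only [map_add, map_smul, mink_add_left] at ef ⊢
  linear_combination (norm := module) -ef

end LaplacianProperties

/-! ### Orthonormal frame fields -/

section Frame

variable {X : Plane → Mink4} {U : Set Plane}

lemma contDiffOn_mink {n : ℕ∞ω} {v w : Plane → Mink4} (hv : ContDiffOn ℝ n v U)
    (hw : ContDiffOn ℝ n w U) : ContDiffOn ℝ n (fun y => mink (v y) (w y)) U := by
  have hv' := contDiffOn_pi.1 hv
  have hw' := contDiffOn_pi.1 hw
  exact ((((hv' 0).mul (hw' 0)).neg.add ((hv' 1).mul (hw' 1))).add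
    ((hv' 2).mul (hw' 2))).add ((hv' 3).mul (hw' 3))

lemma contDiffOn_fderiv_apply {F : Type*} [NormedAddCommGroup F] [NormedSpace ℝ F]
    (hU : IsOpen U) {f : Plane → F} (hf : ContDiffOn ℝ ∞ f U) {E : Plane → Plane}
    (hE : ContDiffOn ℝ ∞ E U) : ContDiffOn ℝ ∞ (fun y => fderiv ℝ f y (E y)) U :=
  (hf.fderiv_of_isOpen hU (by simp)).clm_apply hE

/-- The Gram-Schmidt frame of a space-like immersion. -/
theorem exists_orthonormal_frame (hU : IsOpen U) (hX : ContDiffOn ℝ ∞ X U)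
    (hpos : ∀ u ∈ U, ∀ z, z ≠ 0 → 0 < mink (fderiv ℝ X u z) (fderiv ℝ X u z)) :
    ∃ E₁ E₂ : Plane → Plane, ContDiffOn ℝ ∞ E₁ U ∧ ContDiffOn ℝ ∞ E₂ U ∧
      ∀ u ∈ U, IsOrthonormalAt X u (E₁ u) (E₂ u) := by
  set a : Plane := EuclideanSpace.single 0 1 with ha
  set b : Plane := EuclideanSpace.single 1 1 with hb
  have sm {v : Plane → Plane} (hv : ContDiffOn ℝ ∞ v U) (h0 : ∀ u ∈ U, v u ≠ 0) :
      ContDiffOn ℝ ∞ (fun u => (√(mink (fderiv ℝ X u (v u)) (fderiv ℝ X u (v u))))⁻¹ • v u) U := by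
    have hd := contDiffOn_fderiv_apply hU hX hv
    exact (((contDiffOn_mink hd hd).sqrt fun u hu => (hpos u hu _ (h0 u hu)).ne').inv
      fun u hu => (Real.sqrt_pos.2 (hpos u hu _ (h0 u hu))).ne').smul hv
  have unit {u v : Plane} (hu : u ∈ U) (hv : v ≠ 0) :
      mink (fderiv ℝ X u ((√(mink (fderiv ℝ X u v) (fderiv ℝ X u v)))⁻¹ • v))
        (fderiv ℝ X u ((√(mink (fderiv ℝ X u v) (fderiv ℝ X u v)))⁻¹ • v)) = 1 := by
    have hp := hpos u hu v hv
    have hs := Real.sq_sqrt hp.le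
    have hq := Real.sqrt_pos.2 hp
    rw [map_smul, mink_smul_left, mink_smul_right]
    field_simp
    exact hs.symm
  have ha0 : a ≠ 0 := by simp [ha]
  -- The Gram-Schmidt vector scaled by |a|², which avoids a division before normalization.
  set n : Plane → Plane := fun u => mink (fderiv ℝ X u a) (fderiv ℝ X u a) • b
    - mink (fderiv ℝ X u a) (fderiv ℝ X u b) • a with hn
  have hn0 : ∀ u ∈ U, n u ≠ 0 := by
    intro u hu h
    have h₁ := congrArg (fun v : Plane => v 1) h
    simp [hn, ha, hb] at h₁
    exact (hpos u hu a ha0).ne' h₁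
  have ca := contDiffOn_fderiv_apply hU hX (contDiffOn_const (c := a))
  have cb := contDiffOn_fderiv_apply hU hX (contDiffOn_const (c := b))
  have hns : ContDiffOn ℝ ∞ n U :=
    ((contDiffOn_mink ca ca).smul contDiffOn_const).sub
      ((contDiffOn_mink ca cb).smul contDiffOn_const)
  refine ⟨_, _, sm (contDiffOn_const (c := a)) fun _ _ => ha0, sm hns hn0, fun u hu =>
    ⟨unit hu ha0, unit hu (hn0 u hu), ?_⟩⟩
  have hab : mink (fderiv ℝ X u a) (fderiv ℝ X u (n u)) = 0 := by
    simp only [hn, sub_eq_add_neg, ← neg_smul, map_add, map_smul, mink_add_right,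
      mink_smul_right]
    ring
  rw [map_smul, map_smul, mink_smul_left, mink_smul_right, hab]
  simp

/-- Smooth vector fields forming an orthonormal frame of the metric induced by `X` on `U`. -/
structure IsSmoothFrame (X : Plane → Mink4) (U : Set Plane) (E₁ E₂ : Plane → Plane) : Prop where
  isOpen : IsOpen U
  smooth : ContDiffOn ℝ ∞ X U
  smooth₁ : ContDiffOn ℝ ∞ E₁ U
  smooth₂ : ContDiffOn ℝ ∞ E₂ U
  orthonormal : ∀ u ∈ U, IsOrthonormalAt X u (E₁ u) (E₂ u)

/-- The derivative of `f` along the vector field `E`. -/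
def along (E : Plane → Plane) {F : Type*} [NormedAddCommGroup F] [NormedSpace ℝ F]
    (f : Plane → F) : Plane → F := fun u => fderiv ℝ f u (E u)

lemma along_def (E : Plane → Plane) {F : Type*} [NormedAddCommGroup F] [NormedSpace ℝ F]
    (f : Plane → F) : along E f = fun u => fderiv ℝ f u (E u) := rfl

namespace IsSmoothFrame

variable {E₁ E₂ : Plane → Plane} (h : IsSmoothFrame X U E₁ E₂) {u : Plane} (hu : u ∈ U)
include h hu

lemma contDiffAt {F : Type*} [NormedAddCommGroup F] [NormedSpace ℝ F] {f : Plane → F}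
    (hf : ContDiffOn ℝ ∞ f U) : ContDiffAt ℝ 2 f u :=
  (hf.contDiffAt (h.isOpen.mem_nhds hu)).of_le (WithTop.coe_le_coe.2 (le_top (a := (2 : ℕ∞))))

lemma differentiableAt {F : Type*} [NormedAddCommGroup F] [NormedSpace ℝ F] {f : Plane → F}
    (hf : ContDiffOn ℝ ∞ f U) : DifferentiableAt ℝ f u :=
  (h.contDiffAt hu hf).differentiableAt (by simp)

lemma frame_relations (z : Plane) :
    mink (fderiv ℝ (along E₁ X) u z) (along E₁ X u) = 0 ∧
    mink (fderiv ℝ (along E₂ X) u z) (along E₂ X u) = 0 ∧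
    mink (fderiv ℝ (along E₂ X) u z) (along E₁ X u) =
      -mink (fderiv ℝ (along E₁ X) u z) (along E₂ X u) := by
  have d₁ := h.differentiableAt hu (contDiffOn_fderiv_apply h.isOpen h.smooth h.smooth₁)
  have d₂ := h.differentiableAt hu (contDiffOn_fderiv_apply h.isOpen h.smooth h.smooth₂)
  have const {v w : Plane → Mink4} {c : ℝ} (hc : ∀ y ∈ U, mink (v y) (w y) = c) :
      fderiv ℝ (fun y => mink (v y) (w y)) u z = 0 := by
    have : (fun y => mink (v y) (w y)) =ᶠ[nhds u] fun _ => c := by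
      filter_upwards [h.isOpen.mem_nhds hu] with y hy using hc y hy
    rw [this.fderiv_eq]; simp
  have h₁ := const fun y hy => (h.orthonormal y hy).fst
  have h₂ := const fun y hy => (h.orthonormal y hy).snd
  have h₃ := const fun y hy => (h.orthonormal y hy).cross
  rw [fderiv_mink d₁ d₁, mink_comm (fderiv ℝ X u _)] at h₁
  rw [fderiv_mink d₂ d₂, mink_comm (fderiv ℝ X u _)] at h₂
  rw [fderiv_mink d₁ d₂, mink_comm (fderiv ℝ X u _)] at h₃
  simp only [along_def]
  refine ⟨?_, ?_, ?_⟩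
  · linear_combination h₁ / 2
  · linear_combination h₂ / 2
  · linear_combination h₃

variable {F : Type*} [NormedAddCommGroup F] [NormedSpace ℝ F] {f : Plane → F}

lemma along_comm_eq_bracket (hf : ContDiffAt ℝ 2 f u) :
    along E₁ (along E₂ f) u - along E₂ (along E₁ f) u =
      fderiv ℝ f u (fderiv ℝ E₂ u (E₁ u) - fderiv ℝ E₁ u (E₂ u)) := by
  have e₁ := fderiv_fderiv_apply hf (h.differentiableAt hu h.smooth₁) (E₂ u)
  have e₂ := fderiv_fderiv_apply hf (h.differentiableAt hu h.smooth₂) (E₁ u)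
  rw [fderiv_fderiv_symm hf] at e₁
  change fderiv ℝ (fun y => fderiv ℝ f y (E₂ y)) u (E₁ u)
    - fderiv ℝ (fun y => fderiv ℝ f y (E₁ y)) u (E₂ u) = _
  rw [e₁, e₂, map_sub]
  abel

/-- Torsion-freeness: the bracket of E₁, E₂ is expanded in the frame, with coefficients found by
applying the bracket formula to X itself. -/
theorem along_comm (hf : ContDiffAt ℝ 2 f u) :
    along E₁ (along E₂ f) u - along E₂ (along E₁ f) u =
      -mink (along E₁ (along E₁ X) u) (along E₂ X u) • along E₁ f u
      - mink (along E₂ (along E₁ X) u) (along E₂ X u) • along E₂ f u := by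
  have hX := h.contDiffAt hu h.smooth
  obtain ⟨-, r₂, r₃⟩ := h.frame_relations hu (E₁ u)
  obtain ⟨r₁, -, -⟩ := h.frame_relations hu (E₂ u)
  have ex := congrArg (fderiv ℝ f u) ((h.orthonormal u hu).expand
    (fderiv ℝ E₂ u (E₁ u) - fderiv ℝ E₁ u (E₂ u)))
  rw [← h.along_comm_eq_bracket hu hX, ← h.along_comm_eq_bracket hu hf, map_add, map_smul,
    map_smul, sub_eq_add_neg (along E₁ (along E₂ X) u), ← neg_one_smul ℝ] at ex
  rw [ex]
  simp only [mink_add_left, mink_smul_left]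
  simp only [along_def] at r₁ r₂ r₃ ⊢
  rw [r₁, r₂, r₃]
  module

/-- The pointwise formula uses fixed vectors. Passing to fields adds the derivatives of E₁, E₂, and
differentiated orthonormality turns the coefficients into p and q. -/
theorem coordLaplacian_eq (hf : ContDiffAt ℝ 2 f u) :
    coordLaplacian X f u = -(along E₁ (along E₁ f) u + along E₂ (along E₂ f) u
      - mink (along E₁ (along E₁ X) u) (along E₂ X u) • along E₂ f u
      + mink (along E₂ (along E₁ X) u) (along E₂ X u) • along E₁ f u) := by
  have hX := h.contDiffAt hu h.smooth
  have d₁ := h.differentiableAt hu h.smooth₁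
  have d₂ := h.differentiableAt hu h.smooth₂
  have e₁ := fderiv_fderiv_apply hf d₁ (E₁ u)
  have e₂ := fderiv_fderiv_apply hf d₂ (E₂ u)
  have x₁ := fderiv_fderiv_apply hX d₁ (E₁ u)
  have x₂ := fderiv_fderiv_apply hX d₂ (E₂ u)
  obtain ⟨r₁, -, -⟩ := h.frame_relations hu (E₁ u)
  obtain ⟨-, r₂, r₃⟩ := h.frame_relations hu (E₂ u)
  have ho := h.orthonormal u hu
  have ex := congrArg (fderiv ℝ f u) (ho.expand (fderiv ℝ E₁ u (E₁ u) + fderiv ℝ E₂ u (E₂ u)))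
  rw [ho.coordLaplacian_eq hX hf]
  simp only [map_add, map_smul, mink_add_left] at ex ⊢
  have x₁' (w : Mink4) := congrArg (fun v => mink v w) x₁
  have x₂' (w : Mink4) := congrArg (fun v => mink v w) x₂
  simp only [mink_add_left] at x₁' x₂'
  simp only [along_def] at r₁ r₂ r₃ ⊢
  rw [e₁, e₂]
  have k₁ : mink (fderiv ℝ (fderiv ℝ X) u (E₁ u) (E₁ u)) (fderiv ℝ X u (E₁ u)) +
      mink (fderiv ℝ (fderiv ℝ X) u (E₂ u) (E₂ u)) (fderiv ℝ X u (E₁ u)) =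
      -mink (fderiv ℝ (fun y => fderiv ℝ X y (E₁ y)) u (E₂ u)) (fderiv ℝ X u (E₂ u))
      - (mink (fderiv ℝ X u (fderiv ℝ E₁ u (E₁ u))) (fderiv ℝ X u (E₁ u)) +
        mink (fderiv ℝ X u (fderiv ℝ E₂ u (E₂ u))) (fderiv ℝ X u (E₁ u))) := by
    linear_combination r₁ + r₃ - x₁' (fderiv ℝ X u (E₁ u)) - x₂' (fderiv ℝ X u (E₁ u))
  have k₂ : mink (fderiv ℝ (fderiv ℝ X) u (E₁ u) (E₁ u)) (fderiv ℝ X u (E₂ u)) +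
      mink (fderiv ℝ (fderiv ℝ X) u (E₂ u) (E₂ u)) (fderiv ℝ X u (E₂ u)) =
      mink (fderiv ℝ (fun y => fderiv ℝ X y (E₁ y)) u (E₁ u)) (fderiv ℝ X u (E₂ u))
      - (mink (fderiv ℝ X u (fderiv ℝ E₁ u (E₁ u))) (fderiv ℝ X u (E₂ u)) +
        mink (fderiv ℝ X u (fderiv ℝ E₂ u (E₂ u))) (fderiv ℝ X u (E₂ u))) := by
    linear_combination r₂ - x₁' (fderiv ℝ X u (E₂ u)) - x₂' (fderiv ℝ X u (E₂ u))
  rw [k₁, k₂]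
  linear_combination (norm := module) ex

end IsSmoothFrame

end Frame

/-! ### The ring of smooth functions on an open set and its derivations -/

section SmoothFunctions

variable {U : Set Plane}

/-- Extension by zero of a function on a set of the plane. -/
def extendZero (f : U → ℝ) : Plane → ℝ := Function.extend Subtype.val f 0

lemma extendZero_apply (f : U → ℝ) (u : U) : extendZero f u = f u :=
  Subtype.val_injective.extend_apply _ _ _

variable (U) in
/-- The algebra of smooth functions on `U`. -/
def smoothFunctions : Subalgebra ℝ (U → ℝ) where
  -- Elements live on U alone, so equality in the ring is equality on U; for open U the values of
  -- the extension outside do not affect derivatives.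
  carrier := {f | ContDiffOn ℝ ∞ (extendZero f) U}
  mul_mem' {f g} hf hg := (ContDiffOn.mul hf hg).congr fun u hu => by
    simp [extendZero_apply _ ⟨u, hu⟩]
  add_mem' {f g} hf hg := (ContDiffOn.add hf hg).congr fun u hu => by
    simp [extendZero_apply _ ⟨u, hu⟩]
  algebraMap_mem' c := (contDiffOn_const (c := c)).congr fun u hu => by
    simp [extendZero_apply _ ⟨u, hu⟩]

lemma smooth_extend (f : smoothFunctions U) : ContDiffOn ℝ ∞ (extendZero f.1) U := f.2

/-- The restriction to `U` of a function smooth on `U`. -/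
def restrict (f : Plane → ℝ) (hf : ContDiffOn ℝ ∞ f U) : smoothFunctions U :=
  ⟨fun u => f u, hf.congr fun u hu => extendZero_apply _ ⟨u, hu⟩⟩

lemma restrict_apply {f : Plane → ℝ} (hf : ContDiffOn ℝ ∞ f U) (u : U) :
    (restrict f hf).1 u = f u := rfl

lemma extendZero_eventuallyEq (hU : IsOpen U) {f : U → ℝ} {g : Plane → ℝ}
    (h : ∀ u : U, f u = g u) (u : U) : extendZero f =ᶠ[nhds u.1] g := by
  filter_upwards [hU.mem_nhds u.2] with y hy
  exact (extendZero_apply f ⟨y, hy⟩).trans (h ⟨y, hy⟩)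

lemma contDiffOn_along {F : Type*} [NormedAddCommGroup F] [NormedSpace ℝ F] (hU : IsOpen U)
    {f : Plane → F} (hf : ContDiffOn ℝ ∞ f U) {E : Plane → Plane} (hE : ContDiffOn ℝ ∞ E U) :
    ContDiffOn ℝ ∞ (along E f) U :=
  contDiffOn_fderiv_apply hU hf hE

/-- The derivation of the algebra of smooth functions given by a smooth vector field. -/
def fieldDerivation (hU : IsOpen U) (E : Plane → Plane) (hE : ContDiffOn ℝ ∞ E U) :
    Derivation ℝ (smoothFunctions U) (smoothFunctions U) :=
  have hd (f : smoothFunctions U) (u : U) : DifferentiableAt ℝ (extendZero f.1) u :=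
    ((smooth_extend f).contDiffAt (hU.mem_nhds u.2)).differentiableAt (by simp)
  Derivation.mk'
    { toFun := fun f => restrict (along E (extendZero f.1))
        (contDiffOn_along hU (smooth_extend f) hE)
      map_add' := fun f g => by
        ext u
        have := (extendZero_eventuallyEq hU (f := (f + g).1)
          (g := fun y => extendZero f.1 y + extendZero g.1 y)
          (fun u => by simp [extendZero_apply]) u).fderiv_eq (𝕜 := ℝ)
        change fderiv ℝ (extendZero (f + g).1) u (E u) = _
        rw [this, fderiv_fun_add (hd f u) (hd g u)]
        rfl
      map_smul' := fun c f => by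
        ext u
        have := (extendZero_eventuallyEq hU (f := (c • f).1) (g := fun y => c • extendZero f.1 y)
          (fun u => by simp [extendZero_apply]) u).fderiv_eq (𝕜 := ℝ)
        change fderiv ℝ (extendZero (c • f).1) u (E u) = _
        rw [this, fderiv_fun_const_smul (hd f u)]
        rfl }
    fun f g => by
      ext u
      have := (extendZero_eventuallyEq hU (f := (f * g).1)
          (g := fun y => extendZero f.1 y * extendZero g.1 y)
          (fun u => by simp [extendZero_apply]) u).fderiv_eq (𝕜 := ℝ)
      change fderiv ℝ (extendZero (f * g).1) u (E u) = f.1 u * along E (extendZero g.1) u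
        + g.1 u * along E (extendZero f.1) u
      rw [this, fderiv_fun_mul (hd f u) (hd g u)]
      simp [along, extendZero_apply]

lemma fieldDerivation_apply (hU : IsOpen U) {E : Plane → Plane} (hE : ContDiffOn ℝ ∞ E U)
    {f : smoothFunctions U} {g : Plane → ℝ} (h : ∀ u : U, f.1 u = g u) (u : U) :
    (fieldDerivation hU E hE f).1 u = along E g u := by
  change fderiv ℝ (extendZero f.1) u (E u) = _
  rw [(extendZero_eventuallyEq hU h u).fderiv_eq]
  rfl

instance : IsReduced (smoothFunctions U) :=
  isReduced_of_injective (smoothFunctions U).subtype Subtype.val_injective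

lemma eq_zero_of_sq_add_sq (a b : smoothFunctions U) (h : a ^ 2 + b ^ 2 = 0) : a = 0 := by
  ext u
  have h' : a.1 u ^ 2 + b.1 u ^ 2 = 0 := congrFun (congrArg Subtype.val h) u
  have : a.1 u ^ 2 = 0 := by nlinarith [sq_nonneg (a.1 u), sq_nonneg (b.1 u)]
  exact pow_eq_zero_iff two_ne_zero |>.1 this

lemma isUnit_of_ne_zero {f : smoothFunctions U} (h : ∀ u, f.1 u ≠ 0) : IsUnit f := by
  have hs : ContDiffOn ℝ ∞ (fun y => (extendZero f.1 y)⁻¹) U :=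
    (smooth_extend f).inv fun u hu => by rw [extendZero_apply _ ⟨u, hu⟩]; exact h _
  refine IsUnit.of_mul_eq_one (restrict _ hs) ?_
  ext u
  change f.1 u * (extendZero f.1 u)⁻¹ = 1
  rw [extendZero_apply, mul_inv_cancel₀ (h u)]

lemma rmink_apply (v w : Fin 4 → smoothFunctions U) (u : U) :
    (rmink v w).1 u = mink (fun k => (v k).1 u) (fun k => (w k).1 u) := rfl

end SmoothFunctions

/-! ### The adapted frame of a parametrized surface -/

section LocalFrame

variable {X : Plane → Mink4} {U : Set Plane}

lemma along_apply {ι : Type*} [Fintype ι] {E : Plane → Plane} {f : Plane → ι → ℝ} {u : Plane}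
    (hf : DifferentiableAt ℝ f u) (k : ι) : along E (fun y => f y k) u = along E f u k := by
  have := (hasFDerivAt_pi'.1 hf.hasFDerivAt k).fderiv
  simp only [along, this]
  rfl

lemma IsLightlike.zero_ne {v : Mink4} (h : IsLightlike v) : v 0 ≠ 0 := by
  intro h₀
  obtain ⟨h₁, h₂⟩ := h
  rw [mink, h₀] at h₂
  have e₁ : v 1 = 0 := by nlinarith [sq_nonneg (v 1), sq_nonneg (v 2), sq_nonneg (v 3)]
  have e₂ : v 2 = 0 := by nlinarith [sq_nonneg (v 1), sq_nonneg (v 2), sq_nonneg (v 3)]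
  have e₃ : v 3 = 0 := by nlinarith [sq_nonneg (v 1), sq_nonneg (v 2), sq_nonneg (v 3)]
  exact h₁ (funext fun k => by fin_cases k; exacts [h₀, e₁, e₂, e₃])

/-- Beltrami's formula Δx = -2H. It transfers smoothness and coordinate invariance from the
Laplacian to H. -/
lemma coordMeanCurvature_eq (u : Plane) :
    coordMeanCurvature X u = (-(1 / 2) : ℝ) • coordLaplacian X X u := by
  simp only [coordMeanCurvature, coordLaplacian, secondFundamentalForm]
  module

/-- The adapted frame, over the ring of smooth functions, of a space-like immersion with light-like
mean curvature vector. -/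
theorem exists_local_adaptedFrame (hU : IsOpen U) (hX : ContDiffOn ℝ ∞ X U)
    (hpos : ∀ u ∈ U, ∀ z, z ≠ 0 → 0 < mink (fderiv ℝ X u z) (fderiv ℝ X u z))
    (hl : ∀ u ∈ U, IsLightlike (coordMeanCurvature X u)) :
    ∃ S : AdaptedFrame (smoothFunctions U),
      (∀ f (hf : ContDiffOn ℝ ∞ f U) (u : U), (S.lap (restrict f hf)).1 u = coordLaplacian X f u) ∧
      (∀ k, S.D₁ (restrict (fun y => X y k) (contDiffOn_pi.1 hX k)) = S.e₁ k) ∧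
      (∀ k, S.D₂ (restrict (fun y => X y k) (contDiffOn_pi.1 hX k)) = S.e₂ k) ∧
      (∀ k u, (S.H k).1 u = coordMeanCurvature X u k) ∧
      ∀ u : U, ∃ v₁ v₂, IsOrthonormalAt X u v₁ v₂ ∧
        (fun k => (S.e₁ k).1 u) = fderiv ℝ X u v₁ ∧ (fun k => (S.e₂ k).1 u) = fderiv ℝ X u v₂ := by
  obtain ⟨E₁, E₂, hE₁, hE₂, ho⟩ := exists_orthonormal_frame hU hX hpos
  have hfr : IsSmoothFrame X U E₁ E₂ := ⟨hU, hX, hE₁, hE₂, ho⟩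
  set D₁ := fieldDerivation hU E₁ hE₁
  set D₂ := fieldDerivation hU E₂ hE₂
  have c₁ : ContDiffOn ℝ ∞ (along E₁ X) U := contDiffOn_along hU hX hE₁
  have c₂ : ContDiffOn ℝ ∞ (along E₂ X) U := contDiffOn_along hU hX hE₂
  have hXk k := contDiffOn_pi.1 hX k
  have dX {u : Plane} (hu : u ∈ U) := hfr.differentiableAt hu hX
  set x : Fin 4 → smoothFunctions U := fun k => restrict (fun y => X y k) (hXk k) with hx
  set e₁ : Fin 4 → smoothFunctions U := fun k => D₁ (x k) with he₁
  set e₂ : Fin 4 → smoothFunctions U := fun k => D₂ (x k) with he₂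
  have v₁ (k : Fin 4) (u : U) : (e₁ k).1 u = along E₁ X u k :=
    (fieldDerivation_apply hU hE₁ (fun _ => rfl) u).trans (along_apply (dX u.2) k)
  have v₂ (k : Fin 4) (u : U) : (e₂ k).1 u = along E₂ X u k :=
    (fieldDerivation_apply hU hE₂ (fun _ => rfl) u).trans (along_apply (dX u.2) k)
  have v₁₁ (k : Fin 4) (u : U) : (D₁ (e₁ k)).1 u = along E₁ (along E₁ X) u k :=
    (fieldDerivation_apply hU hE₁ (v₁ k) u).trans (along_apply (hfr.differentiableAt u.2 c₁) k)
  have v₂₁ (k : Fin 4) (u : U) : (D₂ (e₁ k)).1 u = along E₂ (along E₁ X) u k :=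
    (fieldDerivation_apply hU hE₂ (v₁ k) u).trans (along_apply (hfr.differentiableAt u.2 c₁) k)
  have v₂₂ (k : Fin 4) (u : U) : (D₂ (e₂ k)).1 u = along E₂ (along E₂ X) u k :=
    (fieldDerivation_apply hU hE₂ (v₂ k) u).trans (along_apply (hfr.differentiableAt u.2 c₂) k)
  set p := rmink (fun k => D₁ (e₁ k)) e₂ with hp
  set q := rmink (fun k => D₂ (e₁ k)) e₂ with hq
  have vp (u : U) : p.1 u = mink (along E₁ (along E₁ X) u) (along E₂ X u) := by
    rw [hp, rmink_apply]; simp only [v₁₁, v₂]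
  have vq (u : U) : q.1 u = mink (along E₂ (along E₁ X) u) (along E₂ X u) := by
    rw [hq, rmink_apply]; simp only [v₂₁, v₂]
  have comm (f : smoothFunctions U) : D₁ (D₂ f) - D₂ (D₁ f) = -p * D₁ f - q * D₂ f := by
    ext u
    have hf (u : U) : f.1 u = extendZero f.1 u := (extendZero_apply _ _).symm
    have f₁ := fieldDerivation_apply hU hE₁ hf
    have f₂ := fieldDerivation_apply hU hE₂ hf
    have f₁₂ := fieldDerivation_apply hU hE₁ f₂
    have f₂₁ := fieldDerivation_apply hU hE₂ f₁
    have := hfr.along_comm u.2 (hfr.contDiffAt u.2 (smooth_extend f))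
    rw [← f₁₂, ← f₂₁, ← f₁, ← f₂, ← vp, ← vq] at this
    exact this
  have lap {f : Plane → ℝ} (hf : ContDiffOn ℝ ∞ f U) (u : U) :
      (-(D₁ (D₁ (restrict f hf)) + D₂ (D₂ (restrict f hf)) - p * D₂ (restrict f hf)
        + q * D₁ (restrict f hf)) : smoothFunctions U).1 u = coordLaplacian X f u := by
    have f₁ := fieldDerivation_apply hU hE₁ (restrict_apply hf)
    have f₂ := fieldDerivation_apply hU hE₂ (restrict_apply hf)
    have f₁₁ := fieldDerivation_apply hU hE₁ f₁
    have f₂₂ := fieldDerivation_apply hU hE₂ f₂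
    rw [hfr.coordLaplacian_eq u.2 (hfr.contDiffAt u.2 hf), ← f₁₁, ← f₂₂, ← f₁, ← f₂, ← vp, ← vq]
    rfl
  set H : Fin 4 → smoothFunctions U := fun k =>
    (1 / 2 : ℝ) • (D₁ (e₁ k) + D₂ (e₂ k) - p * e₂ k + q * e₁ k) with hH
  have vH (k : Fin 4) (u : U) : (H k).1 u = coordMeanCurvature X u k := by
    have h₁ := lap (hXk k) u
    have h₂ := coordLaplacian_clm_comp (ho u u.2) (hfr.contDiffAt u.2 hX)
      (ContinuousLinearMap.proj (R := ℝ) (φ := fun _ : Fin 4 => ℝ) k) (hfr.contDiffAt u.2 hX)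
    have h₃ := h₁.trans h₂
    rw [coordMeanCurvature_eq, Pi.smul_apply]
    change (H k).1 u = (-(1 / 2) : ℝ) •
      (ContinuousLinearMap.proj (R := ℝ) (φ := fun _ : Fin 4 => ℝ) k) (coordLaplacian X X u)
    rw [← h₃]
    change (1 / 2 : ℝ) * (D₁ (e₁ k) + D₂ (e₂ k) - p * e₂ k + q * e₁ k).1 u =
      (-(1 / 2) : ℝ) * -(D₁ (e₁ k) + D₂ (e₂ k) - p * e₂ k + q * e₁ k).1 u
    ring
  obtain ⟨S, hD₁, hD₂, hS₁, hS₂, hSH, hSp, hSq⟩ := exists_adaptedFrame D₁ D₂ (H := H)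
    (e₁ := e₁) (e₂ := e₂) (p := p) (q := q)
    (by ext u; rw [rmink_apply]; simp only [v₁]; exact (ho u u.2).fst)
    (by ext u; rw [rmink_apply]; simp only [v₂]; exact (ho u u.2).snd)
    (by ext u; rw [rmink_apply]; simp only [v₁, v₂]; exact (ho u u.2).cross)
    -- Symmetry of the second fundamental form is the commutator relation applied to the coordinate
    -- functions of X.
    rfl rfl comm (fun k => comm (x k))
    (fun k => by
      have : (2 : smoothFunctions U) = algebraMap ℝ _ 2 := (map_ofNat _ 2).symm
      rw [hH, this, ← Algebra.smul_def, smul_smul]; norm_num)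
    (by ext u; rw [rmink_apply]; simp only [vH]; exact (hl u u.2).2)
    (isUnit_of_ne_zero fun u => by rw [vH]; exact (hl u u.2).zero_ne)
  refine ⟨S, fun f hf u => ?_, fun k => by rw [hS₁, hD₁], fun k => by rw [hS₂, hD₂],
    fun k u => by rw [hSH, vH], fun u => ⟨E₁ u, E₂ u, ho u u.2, ?_, ?_⟩⟩
  · rw [← lap hf, AdaptedFrame.lap, hD₁, hD₂, hSp, hSq]
  · ext k; rw [hS₁, v₁]; rfl
  · ext k; rw [hS₂, v₂]; rfl

end LocalFrame

/-! ### Local form of the theorem -/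

section LocalTheorem

variable {X : Plane → Mink4} {U : Set Plane}

lemma contDiffOn_coordMeanCurvature (hU : IsOpen U) (hX : ContDiffOn ℝ ∞ X U)
    (hpos : ∀ u ∈ U, ∀ z, z ≠ 0 → 0 < mink (fderiv ℝ X u z) (fderiv ℝ X u z))
    (hl : ∀ u ∈ U, IsLightlike (coordMeanCurvature X u)) :
    ContDiffOn ℝ ∞ (coordMeanCurvature X) U := by
  obtain ⟨S, -, -, -, hH, -⟩ := exists_local_adaptedFrame hU hX hpos hl
  exact contDiffOn_pi.2 fun k => (smooth_extend (S.H k)).congr fun u hu =>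
    (hH k ⟨u, hu⟩).symm.trans (extendZero_apply _ ⟨u, hu⟩).symm

/-- The position vector is not, up to a translation, a multiple of the mean curvature vector. -/
lemma not_radial (hU : IsOpen U) (hne : U.Nonempty) (hX : ContDiffOn ℝ ∞ X U)
    (hpos : ∀ u ∈ U, ∀ z, z ≠ 0 → 0 < mink (fderiv ℝ X u z) (fderiv ℝ X u z))
    (hl : ∀ u ∈ U, IsLightlike (coordMeanCurvature X u)) (c : Mink4) (μ : ℝ)
    (h : ∀ u ∈ U, X u = c + μ • coordMeanCurvature X u) : False := by
  obtain ⟨S, -, h₁, h₂, hH, -⟩ := exists_local_adaptedFrame hU hX hpos hl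
  have hx (k : Fin 4) : restrict (fun y => X y k) (contDiffOn_pi.1 hX k) =
      algebraMap ℝ (smoothFunctions U) (c k) + algebraMap ℝ (smoothFunctions U) μ * S.H k := by
    ext u
    change X u k = c k + μ * (S.H k).1 u
    rw [hH]
    exact congrFun (h u u.2) k
  have k₁ (k : Fin 4) : algebraMap ℝ (smoothFunctions U) μ * S.D₁ (S.H k) = S.e₁ k := by
    rw [← h₁, hx, map_add, Derivation.map_algebraMap, Derivation.leibniz,
      Derivation.map_algebraMap, smul_zero, zero_add, add_zero, smul_eq_mul]
  have k₂ (k : Fin 4) : algebraMap ℝ (smoothFunctions U) μ * S.D₂ (S.H k) = S.e₂ k := by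
    rw [← h₂, hx, map_add, Derivation.map_algebraMap, Derivation.leibniz,
      Derivation.map_algebraMap, smul_zero, zero_add, add_zero, smul_eq_mul]
  set m := algebraMap ℝ (smoothFunctions U) μ
  have c₁ := S.coeff_eq_zero (α := -m * S.a - 1) (β := -m * S.b) (γ := m * S.ω₁) (δ := 0)
    fun k => by linear_combination k₁ k - m * S.D₁H k
  have c₂ := S.coeff_eq_zero (α := -m * S.b) (β := m * S.a - 1) (γ := m * S.ω₂) (δ := 0)
    fun k => by linear_combination k₂ k - m * S.D₂H k
  -- Both diagonal entries of the shape operator of H, multiplied by -μ, would be 1, but its trace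
  -- is 0. This is absurd because U is non-empty.
  have h2 : (2 : smoothFunctions U) = 0 := by linear_combination -c₁.1 - c₂.2.1
  obtain ⟨u, hu⟩ := hne
  have : (2 : ℝ) = 0 := congrFun (congrArg Subtype.val h2) ⟨u, hu⟩
  norm_num at this

lemma rwedge_swap {R : Type*} [CommRing R] (v w : Fin 4 → R) (i j : Fin 4) :
    rwedge v w j i = -rwedge v w i j := by simp only [rwedge]; ring

lemma forall_of_lt {P : Fin 4 → Fin 4 → Prop} (h : ∀ q : {q : Fin 4 × Fin 4 // q.1 < q.2},
    P q.1.1 q.1.2) (hs : ∀ i j, P i j → P j i) (hd : ∀ i, P i i) (i j : Fin 4) : P i j := by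
  rcases lt_trichotomy i j with hij | rfl | hij
  exacts [h ⟨(i, j), hij⟩, hd i, hs _ _ (h ⟨(j, i), hij⟩)]

/-- The wedge products of two orthonormal bases of a plane agree up to sign. -/
lemma wedge_eq_sign_smul {u v₁ v₂ z₁ z₂ : Plane} (h : IsOrthonormalAt X u v₁ v₂)
    (h' : IsOrthonormalAt X u z₁ z₂) :
    ∃ s : ℝ, s * s = 1 ∧ wedge (fderiv ℝ X u z₁) (fderiv ℝ X u z₂) =
      s • wedge (fderiv ℝ X u v₁) (fderiv ℝ X u v₂) := by
  have e₁ := congrArg (fderiv ℝ X u) (h.expand z₁)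
  have e₂ := congrArg (fderiv ℝ X u) (h.expand z₂)
  rw [map_add, map_smul, map_smul] at e₁ e₂
  set α := mink (fderiv ℝ X u z₁) (fderiv ℝ X u v₁)
  set β := mink (fderiv ℝ X u z₁) (fderiv ℝ X u v₂)
  set γ := mink (fderiv ℝ X u z₂) (fderiv ℝ X u v₁)
  set δ := mink (fderiv ℝ X u z₂) (fderiv ℝ X u v₂)
  have f₁ := h'.fst
  have f₂ := h'.snd
  have f₃ := h'.cross
  have h₂₁ := (mink_comm _ _).trans h.cross
  rw [e₁] at f₁
  rw [e₂] at f₂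
  rw [e₁, e₂] at f₃
  simp only [mink_add_left, mink_add_right, mink_smul_left, mink_smul_right, h.fst, h.snd,
    h.cross, h₂₁] at f₁ f₂ f₃
  refine ⟨α * δ - β * γ, ?_, ?_⟩
  · linear_combination (γ ^ 2 + δ ^ 2) * f₁ + f₂ - (α * γ + β * δ) * f₃
  · rw [e₁, e₂]
    ext q
    simp only [wedge, Pi.add_apply, Pi.smul_apply, smul_eq_mul]
    ring

/-- For a Gauss map of 1-type with non-zero eigenvalue, the mean curvature vector is an eigenvector
of the Laplacian. -/
theorem coordLaplacian_coordMeanCurvature (hU : IsOpen U) (hX : ContDiffOn ℝ ∞ X U)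
    (hpos : ∀ u ∈ U, ∀ z, z ≠ 0 → 0 < mink (fderiv ℝ X u z) (fderiv ℝ X u z))
    (hl : ∀ u ∈ U, IsLightlike (coordMeanCurvature X u)) {N : Plane → BiVec}
    (hN : ContDiffOn ℝ ∞ N U)
    (hNw : ∀ u ∈ U, ∃ z₁ z₂, IsOrthonormalAt X u z₁ z₂ ∧
      N u = wedge (fderiv ℝ X u z₁) (fderiv ℝ X u z₂))
    {lam : ℝ} (hlam : lam ≠ 0) {C : BiVec}
    (hone : ∀ u ∈ U, coordLaplacian X N u = lam • (N u + C)) (u : Plane) (hu : u ∈ U) :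
    coordLaplacian X (coordMeanCurvature X) u = lam • coordMeanCurvature X u := by
  obtain ⟨S, hlap, -, -, hH, hw⟩ := exists_local_adaptedFrame hU hX hpos hl
  have two {F : Type} [NormedAddCommGroup F] [NormedSpace ℝ F] {f : Plane → F}
      (hf : ContDiffOn ℝ ∞ f U) {y : Plane} (hy : y ∈ U) : ContDiffAt ℝ 2 f y :=
    (hf.contDiffAt (hU.mem_nhds hy)).of_le (WithTop.coe_le_coe.2 (le_top (a := (2 : ℕ∞))))
  have comp {ι : Type} [Fintype ι] {f : Plane → ι → ℝ} (hf : ContDiffOn ℝ ∞ f U) (y : U) (k : ι) :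
      (S.lap (restrict (fun y => f y k) (contDiffOn_pi.1 hf k))).1 y = coordLaplacian X f y k := by
    obtain ⟨v₁, v₂, ho, -⟩ := hw y
    rw [hlap]
    exact coordLaplacian_clm_comp ho (two hX y.2)
      (ContinuousLinearMap.proj (R := ℝ) (φ := fun _ : ι => ℝ) k) (two hf y.2)
  set w : {q : Fin 4 × Fin 4 // q.1 < q.2} → smoothFunctions U :=
    fun q => rwedge S.e₁ S.e₂ q.1.1 q.1.2 with hw_def
  set n : {q : Fin 4 × Fin 4 // q.1 < q.2} → smoothFunctions U :=
    fun q => restrict (fun y => N y q) (contDiffOn_pi.1 hN q) with hn_def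
  have sign (y : U) : ∃ s : ℝ, s * s = 1 ∧ ∀ q, (n q).1 y = s * (w q).1 y := by
    obtain ⟨v₁, v₂, ho, hv₁, hv₂⟩ := hw y
    obtain ⟨z₁, z₂, hz, hNz⟩ := hNw y y.2
    obtain ⟨s, hs, hsw⟩ := wedge_eq_sign_smul ho hz
    refine ⟨s, hs, fun q => ?_⟩
    have := congrFun (hNz.trans hsw) q
    rw [← hv₁, ← hv₂] at this
    exact this
  have hT : IsUnit (∑ q, w q * w q) := by
    refine isUnit_of_ne_zero fun y h0 => ?_
    have hsum : ∑ q, (w q).1 y * (w q).1 y = 0 := by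
      rw [← h0]
      simp
    have hz (q) : (w q).1 y = 0 := mul_self_eq_zero.1
      ((Finset.sum_eq_zero_iff_of_nonneg fun q _ => mul_self_nonneg _).1 hsum q (Finset.mem_univ q))
    have hall : ∀ i j, (rwedge S.e₁ S.e₂ i j).1 y = 0 :=
      forall_of_lt (P := fun i j => (rwedge S.e₁ S.e₂ i j).1 y = 0) hz
        (fun i j h => by rw [rwedge_swap]; simp [h]) (fun i => by simp [rwedge])
    -- Contracting e₁∧e₂ with e₁, e₂ gives 1, so its coordinates cannot all vanish.
    have hc := congrFun (congrArg Subtype.val (contract_rwedge S.e₁ S.e₂ S.e₁ S.e₂)) y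
    rw [S.e₁e₁, S.e₂e₂, S.e₁e₂] at hc
    have h1 : (contract (rwedge S.e₁ S.e₂) S.e₁ S.e₂).1 y =
      mink (fun i => mink (fun j => (rwedge S.e₁ S.e₂ i j).1 y) fun k => (S.e₂ k).1 y)
        fun k => (S.e₁ k).1 y := rfl
    rw [h1] at hc
    simp [hall, mink] at hc
  obtain ⟨t, ht⟩ := hT.exists_right_inv
  -- The sign relating ν to e₁∧e₂ is a smooth function, being a quotient of Euclidean products of
  -- coordinates. Since s² = 1 its derivatives vanish, so the frame need not match the chosen
  -- orientation.
  set s := (∑ q, n q * w q) * t with hs_def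
  have hsn (y : U) : s.1 y * s.1 y = 1 ∧ ∀ q, (n q).1 y = s.1 y * (w q).1 y := by
    obtain ⟨σ, h₁, h₂⟩ := sign y
    have : s.1 y = σ := by
      have e₁ : (∑ q, n q * w q).1 y = σ * (∑ q, w q * w q).1 y := by
        simp [h₂, Finset.mul_sum, mul_assoc]
      have e₂ : (∑ q, w q * w q).1 y * t.1 y = 1 := congrFun (congrArg Subtype.val ht) y
      change (∑ q, n q * w q).1 y * t.1 y = σ
      rw [e₁, mul_assoc, e₂, mul_one]
    rw [this]
    exact ⟨h₁, h₂⟩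
  have hss : s * s = 1 := by ext y; exact (hsn y).1
  have hn (q) : n q = s * w q := by ext y; exact (hsn y).2 q
  have two_s {D : Derivation ℝ (smoothFunctions U) (smoothFunctions U)} : D s = 0 := by
    have h := congrArg D hss
    rw [Derivation.leibniz, Derivation.map_one_eq_zero, smul_eq_mul] at h
    exact isUnit_two_of_algebra.mul_left_cancel (by linear_combination s * h - 2 * D s * hss)
  have lap_mul (f : smoothFunctions U) : S.lap (s * f) = s * S.lap f := by
    simp only [AdaptedFrame.lap, Derivation.leibniz, two_s, smul_eq_mul, mul_zero, add_zero]
    ring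
  have key (q) : S.lap (w q) - algebraMap ℝ _ lam * w q
      = algebraMap ℝ _ lam * (s * algebraMap ℝ _ (C q)) := by
    have h : S.lap (n q) = algebraMap ℝ _ lam * (n q + algebraMap ℝ _ (C q)) := by
      ext y
      rw [comp hN y q]
      exact congrFun (hone y y.2) q
    rw [hn, lap_mul] at h
    linear_combination s * h - (S.lap (w q) - algebraMap ℝ _ lam * w q) * hss
  have const (D : Derivation ℝ (smoothFunctions U) (smoothFunctions U)) (i j : Fin 4) :
      D (S.lap (rwedge S.e₁ S.e₂ i j) - algebraMap ℝ _ lam * rwedge S.e₁ S.e₂ i j) = 0 := by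
    refine forall_of_lt (P := fun i j => D (S.lap (rwedge S.e₁ S.e₂ i j)
      - algebraMap ℝ _ lam * rwedge S.e₁ S.e₂ i j) = 0) (fun q => ?_) (fun i j h => ?_)
      (fun i => ?_) i j
    · rw [key q]
      simp only [Derivation.leibniz, two_s, Derivation.map_algebraMap, smul_zero, add_zero]
    · rw [rwedge_swap, ← neg_zero, ← h, ← map_neg]
      congr 1
      simp only [AdaptedFrame.lap, map_neg]
      ring
    · rw [show rwedge S.e₁ S.e₂ i i = 0 by simp [rwedge]]
      simp [AdaptedFrame.lap]
  ext k
  have hfin := S.lap_H eq_zero_of_sq_add_sq hlam (const _) (const _) k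
  have hHs := contDiffOn_coordMeanCurvature hU hX hpos hl
  have hHk : S.H k = restrict (fun y => coordMeanCurvature X y k) (contDiffOn_pi.1 hHs k) := by
    ext y; exact hH k y
  rw [← comp hHs ⟨u, hu⟩ k, ← hHk, hfin]
  change lam * (S.H k).1 ⟨u, hu⟩ = lam * coordMeanCurvature X u k
  rw [hH]

end LocalTheorem

/-! ### From the charts to the surface -/

section Charts

variable {M : Type*} [TopologicalSpace M] [ChartedSpace Plane M]

lemma meanCurvature_eq_laplacian (x : M → Mink4) (p : M) :
    meanCurvature x p = (-(1 / 2) : ℝ) • laplacian x x p :=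
  coordMeanCurvature_eq _

lemma inChart_eventuallyEq {G : Type*} [NormedAddCommGroup G] [NormedSpace ℝ G] (f : M → G) (p : M)
    {y : M} (hy : y ∈ (extChartAt (𝓡 2) p).source) :
    inChart y f =ᶠ[nhds (extChartAt (𝓡 2) y y)]
      inChart p f ∘ extChartAt (𝓡 2) p ∘ (extChartAt (𝓡 2) y).symm := by
  have hs : (extChartAt (𝓡 2) p).source ∈
      nhds ((extChartAt (𝓡 2) y).symm (extChartAt (𝓡 2) y y)) := by
    rw [extChartAt_to_inv y]; exact extChartAt_source_mem_nhds' hy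
  filter_upwards [(continuousAt_extChartAt_symm (I := 𝓡 2) y) hs] with v hv
  exact congrArg f ((extChartAt (𝓡 2) p).left_inv hv).symm

variable [IsManifold (𝓡 2) ∞ M]
  {F : Type*} [NormedAddCommGroup F] [NormedSpace ℝ F]

lemma contDiffOn_inChart {f : M → F} (hf : ContMDiff (𝓡 2) 𝓘(ℝ, F) ∞ f) (p : M) :
    ContDiffOn ℝ ∞ (inChart p f) (extChartAt (𝓡 2) p).target :=
  (hf.comp_contMDiffOn (contMDiffOn_extChartAt_symm p)).contDiffOn

lemma contDiffAt_inChart {f : M → F} (hf : ContMDiff (𝓡 2) 𝓘(ℝ, F) ∞ f) (p : M) {u : Plane}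
    (hu : u ∈ (extChartAt (𝓡 2) p).target) : ContDiffAt ℝ 2 (inChart p f) u :=
  ((contDiffOn_inChart hf p).contDiffAt ((isOpen_extChartAt_target p).mem_nhds hu)).of_le
    (WithTop.coe_le_coe.2 (le_top (a := (2 : ℕ∞))))

/-- The isomorphism A is the differential of the inverse chart; it carries space-likeness and
orthonormal bases between M and the plane. -/
lemma fderiv_inChart {x : M → Mink4} (hx : ContMDiff (𝓡 2) 𝓘(ℝ, Mink4) ∞ x) (p : M) {u : Plane}
    (hu : u ∈ (extChartAt (𝓡 2) p).target) :
    ∃ A : Plane ≃L[ℝ] TangentSpace (𝓡 2) ((extChartAt (𝓡 2) p).symm u),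
      ∀ z, fderiv ℝ (inChart p x) u z = push x ((extChartAt (𝓡 2) p).symm u) (A z) := by
  have : IsManifold (𝓡 2) 1 M := IsManifold.of_le (n := ∞) (WithTop.coe_le_coe.2 le_top)
  obtain ⟨A, hA⟩ := isInvertible_mfderivWithin_extChartAt_symm (I := 𝓡 2) hu
  refine ⟨A, fun z => ?_⟩
  have h := mfderiv_comp_mfderivWithin (I := 𝓘(ℝ, Plane)) (I' := 𝓡 2) (I'' := 𝓘(ℝ, Mink4))
    (f := (extChartAt (𝓡 2) p).symm) (g := x) (s := Set.range (𝓡 2)) u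
    ((hx.mdifferentiable (by simp)) _) (mdifferentiableWithinAt_extChartAt_symm hu)
    (by simp [uniqueMDiffWithinAt_univ])
  rw [← hA, mfderivWithin_eq_fderivWithin] at h
  simp only [ModelWithCorners.range_eq_univ, fderivWithin_univ] at h
  exact congrArg (fun B : Plane →L[ℝ] Mink4 => B z) h

lemma spacelike_inChart {x : M → Mink4} (hx : IsSpacelikeSurface x) (p : M) (u : Plane)
    (hu : u ∈ (extChartAt (𝓡 2) p).target) (z : Plane) (hz : z ≠ 0) :
    0 < mink (fderiv ℝ (inChart p x) u z) (fderiv ℝ (inChart p x) u z) := by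
  obtain ⟨A, hA⟩ := fderiv_inChart hx.smooth p hu
  rw [hA]
  exact hx.spacelike _ _ ((map_ne_zero_iff A A.injective).2 hz)

lemma exists_isOrthonormalAt_inChart {x : M → Mink4} (hx : IsSpacelikeSurface x) (p : M)
    {u : Plane} (hu : u ∈ (extChartAt (𝓡 2) p).target) :
    ∃ v₁ v₂, IsOrthonormalAt (inChart p x) u v₁ v₂ := by
  obtain ⟨E₁, E₂, -, -, h⟩ := exists_orthonormal_frame (isOpen_extChartAt_target p)
    (contDiffOn_inChart hx.smooth p) (spacelike_inChart hx p)
  exact ⟨_, _, h u hu⟩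

/-- The Laplacian may be computed in any chart of the preferred atlas. -/
theorem laplacian_eq {x : M → Mink4} (hx : IsSpacelikeSurface x) {f : M → F}
    (hf : ContMDiff (𝓡 2) 𝓘(ℝ, F) ∞ f) (p : M) {y : M} (hy : y ∈ (extChartAt (𝓡 2) p).source) :
    laplacian x f y = coordLaplacian (inChart p x) (inChart p f) (extChartAt (𝓡 2) p y) := by
  set φ := extChartAt (𝓡 2) p
  set ψ := extChartAt (𝓡 2) y
  set T : Plane → Plane := φ ∘ ψ.symm
  have hu : ψ y ∈ ψ.target := mem_extChartAt_target y
  have hTu : T (ψ y) = φ y := congrArg φ (extChartAt_to_inv y)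
  have hT : ContDiffAt ℝ 2 T (ψ y) := by
    have h₁ : ContMDiffAt 𝓘(ℝ, Plane) (𝓡 2) ∞ ψ.symm (ψ y) :=
      (contMDiffOn_extChartAt_symm y).contMDiffAt ((isOpen_extChartAt_target y).mem_nhds hu)
    have h₂ : ContMDiffAt (𝓡 2) 𝓘(ℝ, Plane) ∞ φ (ψ.symm (ψ y)) := by
      rw [extChartAt_to_inv y]
      exact contMDiffAt_extChartAt' (by rwa [← extChartAt_source (𝓡 2)])
    exact (h₂.comp _ h₁).contDiffAt.of_le (WithTop.coe_le_coe.2 (le_top (a := (2 : ℕ∞))))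
  have ht : T (ψ y) ∈ φ.target := hTu ▸ φ.map_source hy
  have dX := contDiffAt_inChart hx.smooth p ht
  have df := contDiffAt_inChart hf p ht
  obtain ⟨v₁, v₂, ho⟩ := exists_isOrthonormalAt_inChart hx y hu
  have ho' : IsOrthonormalAt (inChart p x ∘ T) (ψ y) v₁ v₂ := by
    constructor <;> rw [← (inChart_eventuallyEq x p hy).fderiv_eq]
    exacts [ho.fst, ho.snd, ho.cross]
  rw [← hTu, ← coordLaplacian_comp ho' hT dX df]
  exact coordLaplacian_congr ho' (dX.comp _ hT) (df.comp _ hT) 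
    (inChart_eventuallyEq x p hy) (inChart_eventuallyEq f p hy)

lemma meanCurvature_eq {x : M → Mink4} (hx : IsSpacelikeSurface x) (p : M) {y : M}
    (hy : y ∈ (extChartAt (𝓡 2) p).source) :
    meanCurvature x y = coordMeanCurvature (inChart p x) (extChartAt (𝓡 2) p y) := by
  rw [meanCurvature_eq_laplacian, laplacian_eq hx hx.smooth p hy, coordMeanCurvature_eq]

lemma inChart_meanCurvature {x : M → Mink4} (hx : IsSpacelikeSurface x) (p : M) {u : Plane}
    (hu : u ∈ (extChartAt (𝓡 2) p).target) :
    inChart p (meanCurvature x) u = coordMeanCurvature (inChart p x) u := by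
  have h := meanCurvature_eq hx p ((extChartAt (𝓡 2) p).map_target hu)
  rwa [(extChartAt (𝓡 2) p).right_inv hu] at h

lemma inChart_laplacian {x : M → Mink4} (hx : IsSpacelikeSurface x) {f : M → F}
    (hf : ContMDiff (𝓡 2) 𝓘(ℝ, F) ∞ f) (p : M) {u : Plane}
    (hu : u ∈ (extChartAt (𝓡 2) p).target) :
    laplacian x f ((extChartAt (𝓡 2) p).symm u) =
      coordLaplacian (inChart p x) (inChart p f) u := by
  have h := laplacian_eq hx hf p ((extChartAt (𝓡 2) p).map_target hu)
  rwa [(extChartAt (𝓡 2) p).right_inv hu] at h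

lemma lightlike_inChart {x : M → Mink4} (hx : IsMarginallyTrapped x) (p : M) (u : Plane)
    (hu : u ∈ (extChartAt (𝓡 2) p).target) : IsLightlike (coordMeanCurvature (inChart p x) u) :=
  inChart_meanCurvature hx.toIsSpacelikeSurface p hu ▸ hx.lightlike _

/-- The value at each point is computed in that point's own chart; invariance allows the single
chart at p to be used nearby. -/
lemma contMDiff_meanCurvature {x : M → Mink4} (hx : IsMarginallyTrapped x) :
    ContMDiff (𝓡 2) 𝓘(ℝ, Mink4) ∞ (meanCurvature x) := by
  intro p
  have hx' := hx.toIsSpacelikeSurface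
  have h := (contDiffOn_coordMeanCurvature (isOpen_extChartAt_target p)
    (contDiffOn_inChart hx.smooth p) (spacelike_inChart hx' p) (lightlike_inChart hx p)).contDiffAt
    (extChartAt_target_mem_nhds p)
  refine (h.contMDiffAt.comp p (contMDiffAt_extChartAt (I := 𝓡 2))).congr_of_eventuallyEq ?_
  filter_upwards [extChartAt_source_mem_nhds (I := 𝓡 2) p] with y hy
  exact meanCurvature_eq hx' p hy

lemma gaussMap_inChart {x : M → Mink4} (hx : IsSpacelikeSurface x) {ν : M → BiVec}
    (hν : IsGaussMap x ν) (p : M) (u : Plane) (hu : u ∈ (extChartAt (𝓡 2) p).target) :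
    ∃ z₁ z₂, IsOrthonormalAt (inChart p x) u z₁ z₂ ∧ inChart p ν u =
      wedge (fderiv ℝ (inChart p x) u z₁) (fderiv ℝ (inChart p x) u z₂) := by
  obtain ⟨A, hA⟩ := fderiv_inChart hx.smooth p hu
  obtain ⟨v, w, h₁, h₂, h₃, h₄⟩ := hν.eq_wedge ((extChartAt (𝓡 2) p).symm u)
  have hv : fderiv ℝ (inChart p x) u (A.symm v) = push x _ v := by
    rw [hA, A.apply_symm_apply]
  have hw : fderiv ℝ (inChart p x) u (A.symm w) = push x _ w := by
    rw [hA, A.apply_symm_apply]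
  refine ⟨A.symm v, A.symm w, ⟨?_, ?_, ?_⟩, ?_⟩
  · rw [hv, h₁]
  · rw [hw, h₂]
  · rw [hv, hw, h₃]
  · rw [hv, hw, ← h₄]; rfl

lemma laplacian_smul {x : M → Mink4} (hx : IsSpacelikeSurface x) {f : M → F}
    (hf : ContMDiff (𝓡 2) 𝓘(ℝ, F) ∞ f) (c : ℝ) (p : M) :
    laplacian x (fun y => c • f y) p = c • laplacian x f p := by
  have hu := mem_extChartAt_target (I := 𝓡 2) p
  obtain ⟨v₁, v₂, ho⟩ := exists_isOrthonormalAt_inChart hx p hu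
  exact coordLaplacian_clm_comp ho (contDiffAt_inChart hx.smooth p hu)
    (c • ContinuousLinearMap.id ℝ F) (contDiffAt_inChart hf p hu)

lemma laplacian_sub {x : M → Mink4} (hx : IsSpacelikeSurface x) {f g : M → F}
    (hf : ContMDiff (𝓡 2) 𝓘(ℝ, F) ∞ f) (hg : ContMDiff (𝓡 2) 𝓘(ℝ, F) ∞ g) (p : M) :
    laplacian x (fun y => f y - g y) p = laplacian x f p - laplacian x g p := by
  have hu := mem_extChartAt_target (I := 𝓡 2) p
  obtain ⟨v₁, v₂, ho⟩ := exists_isOrthonormalAt_inChart hx p hu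
  exact coordLaplacian_sub ho (contDiffAt_inChart hx.smooth p hu) (contDiffAt_inChart hf p hu)
    (contDiffAt_inChart hg p hu)

/-- The mean curvature vector of a marginally trapped surface whose Gauss map is of 1-type with
non-zero eigenvalue is an eigenvector of the Laplacian. -/
theorem laplacian_meanCurvature {x : M → Mink4} (hx : IsMarginallyTrapped x) {ν : M → BiVec}
    (hν : IsGaussMap x ν) {lam : ℝ} (hlam : lam ≠ 0) (h : IsOneTypeWith x ν lam) (p : M) :
    laplacian x (meanCurvature x) p = lam • meanCurvature x p := by
  obtain ⟨C, hC⟩ := h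
  have hx' := hx.toIsSpacelikeSurface
  have hu := mem_extChartAt_target (I := 𝓡 2) p
  have hU := isOpen_extChartAt_target (I := 𝓡 2) p
  have key := coordLaplacian_coordMeanCurvature hU (contDiffOn_inChart hx.smooth p)
    (spacelike_inChart hx' p) (lightlike_inChart hx p) (contDiffOn_inChart hν.smooth p)
    (gaussMap_inChart hx' hν p) hlam (C := C)
    (fun u hu => by rw [← inChart_laplacian hx' hν.smooth p hu, hC]; rfl) _ hu
  obtain ⟨v₁, v₂, ho⟩ := exists_isOrthonormalAt_inChart hx' p hu
  have hev : coordMeanCurvature (inChart p x) =ᶠ[nhds (extChartAt (𝓡 2) p p)]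
      inChart p (meanCurvature x) := by
    filter_upwards [hU.mem_nhds hu] with u hu using (inChart_meanCurvature hx' p hu).symm
  rw [coordLaplacian_congr ho (contDiffAt_inChart hx.smooth p hu)
    (contDiffAt_inChart (contMDiff_meanCurvature hx) p hu) Filter.EventuallyEq.rfl hev] at key
  exact key

end Charts

end MargTrapped

end

/-! ### The null 2-type decomposition -/

theorem mainTheorem12 {M : Type*} [TopologicalSpace M] [ChartedSpace MargTrapped.Plane M]
    [IsManifold (𝓡 2) ∞ M] [ConnectedSpace M]
    (x : M → MargTrapped.Mink4) (hx : MargTrapped.IsMarginallyTrapped x)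
    (ν : M → MargTrapped.BiVec) (hν : MargTrapped.IsGaussMap x ν)
    (lam : ℝ) (h_one : MargTrapped.IsOneTypeWith x ν lam)
    (h_nonharm : ¬ MargTrapped.IsHarmonic x ν) :
    MargTrapped.IsNullTwoTypeWith x lam := by
  have hlam : lam ≠ 0 := by
    rintro rfl
    obtain ⟨C, hC⟩ := h_one
    exact h_nonharm fun p => by rw [hC, zero_smul]
  have hx' := hx.toIsSpacelikeSurface
  have hH := MargTrapped.contMDiff_meanCurvature hx
  have hx₁ : ContMDiff (𝓡 2) 𝓘(ℝ, MargTrapped.Mink4) ∞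
      fun p => (-(2 / lam)) • MargTrapped.meanCurvature x p :=
    (contDiff_const_smul (-(2 / lam))).contMDiff.comp hH
  have hΔ (p : M) : MargTrapped.laplacian x
      (fun p => (-(2 / lam)) • MargTrapped.meanCurvature x p) p =
      lam • (-(2 / lam)) • MargTrapped.meanCurvature x p := by
    rw [MargTrapped.laplacian_smul hx' hH, MargTrapped.laplacian_meanCurvature hx hν hlam h_one,
      smul_comm]
  obtain ⟨p⟩ : Nonempty M := inferInstance
  -- The factor -2/λ is chosen so that Δx₁ = λx₁ = -2H = Δx.
  refine ⟨hlam, fun p => x p - (-(2 / lam)) • MargTrapped.meanCurvature x p, _,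
    hx.smooth.sub hx₁, hx₁, fun p => (sub_add_cancel _ _).symm, fun p => ?_, hΔ, ?_, ?_⟩
  · rw [MargTrapped.laplacian_sub hx' hx.smooth hx₁, hΔ, MargTrapped.meanCurvature_eq_laplacian,
      smul_smul, smul_smul]
    have : lam * -(2 / lam) * -(1 / 2) = 1 := by field_simp
    rw [this, one_smul, sub_self]
  · rintro ⟨c, hc⟩
    refine MargTrapped.not_radial (isOpen_extChartAt_target p) ⟨_, mem_extChartAt_target p⟩
      (MargTrapped.contDiffOn_inChart hx.smooth p) (MargTrapped.spacelike_inChart hx' p)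
      (MargTrapped.lightlike_inChart hx p) c (-(2 / lam)) fun u hu => ?_
    rw [← MargTrapped.inChart_meanCurvature hx' p hu]
    exact sub_eq_iff_eq_add.1 (hc ((extChartAt (𝓡 2) p).symm u))
  · rintro ⟨c, hc⟩
    -- A constant x₁ = c satisfies λc = Δc = 0, which forces H = 0 at p.
    have h₁ := hΔ p
    rw [funext hc, hc p] at h₁
    have h₂ : lam • c = 0 := h₁.symm.trans (MargTrapped.coordLaplacian_const c)
    have h₃ := (hc p).trans ((smul_eq_zero_iff_right hlam).1 h₂)
    exact (hx.lightlike p).1 ((smul_eq_zero_iff_right (by simpa using hlam)).1 h₃)
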